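/- Let $q\colon Q\to X$ be a smooth submersion of finite-dimensional smooth manifolds (without boundary). Let $\mathcal G=J^1\mathrm{Diff}_{loc}(q)\rightrightarrows Q$ be the groupoid of $1$-jets $j^1_x\varphi$ of local diffeomorphisms $\varphi$ of $Q$ that lift some local diffeomorphism $\overline\varphi$ of $X$ (i.e. $q\circ\varphi=\overline\varphi\circ q$), with source $s(j^1_x\varphi)=x$ and target $t(j^1_x\varphi)=\varphi(x)$, and let $\overline q\colon\mathcal G\to J^1\mathrm{Diff}_{loc}(X)$, $j^1_x\varphi\mapsto j^1_{q(x)}\overline\varphi$. Let $J^1q=\{h\colon T_{q(x)}X\to T_xQ \text{ linear}\mid x\in Q,\ T_xq\circ h=\mathrm{id}\}$, with projections $p_1\colon J^1q\to Q$ and $\pi=q\circ p_1\colon J^1q\to X$. Consider the Cartan forms \[ (\omega_Q)_{j^1_x\varphi}(W)=Tt(W)-T_x\varphi(Ts(W))\in T_{\varphi(x)}Q,\qquad (\theta_Q)_h(V)=Tp_1(V)-h(T\pi(V))\in\ker T_{p_1(h)}q , \] on $\mathcal G$ and on $J^1q$, and likewise $\omega_X$ on $J^1\mathrm{Diff}_{loc}(X)$.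 Let $\mathcal G\ltimes J^1q=\{(g,h)\in\mathcal G\times J^1q\mid s(g)=p_1(h)\}$, and let $m\colon\mathcal G\ltimes J^1q\to J^1q$ be \[ m(g,h)=g\cdot h=T_x\varphi\circ h\circ(T_{q(x)}\overline\varphi)^{-1}\qquad(g=j^1_x\varphi). \] Then $\overline q$ is smooth, $m$ is a smooth action of the groupoid $\mathcal G$ on $J^1q$ along $p_1$, and the following hold. (1) At each point $(g,h)\in\mathcal G\ltimes J^1q$, as $T_{t(g)}Q$-valued forms on $T_{(g,h)}(\mathcal G\ltimes J^1q)$, \[ \mathrm{pr}_{\mathcal G}^*\omega_Q-(g\cdot h)\circ(\overline q^*\omega_X)=m^*\theta_Q-g\cdot(\mathrm{pr}_{J^1q}^*\theta_Q), \] where $g=j^1_x\varphi$ acts on $T_xQ$ by $T_x\varphi$. (2) If $Q\neq\emptyset$ and $\dim X\ge1$, the action is not a Pfaffian action: with the coefficients $\ker Tq$ of $\theta_Q$ included in $TQ$, the identity $\mathrm{pr}_{\mathcal G}^*\omega_Q=m^*\theta_Q-g\cdot(\mathrm{pr}_{J^1q}^*\theta_Q)$ does not hold on all of $\mathcal G\ltimes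 J^1q$. (3) The action is an action by Pfaffian symmetries: with $\mathcal H=\ker\omega_Q$, $\mathcal C=\ker\theta_Q$ and $\mathcal C^\pi=\mathcal C\cap\ker T\pi$, \[ Tm\big(\mathcal H\times_{TQ}\mathcal C\big)\subseteq\mathcal C,\qquad Tm\big(\mathcal H\times_{TQ}\mathcal C^\pi\big)\subseteq\mathcal C^\pi , \] the fibre products being taken along $Ts$ and $Tp_1$. -/

import Mathlib

open Set Filter Bundle Manifold
open scoped Manifold ContDiff Topology

noncomputable section

/-! ### Calculus on subsets of manifolds

The jet spaces below are embedded submanifolds of a manifold of `1`-jets. Tangent vectors, smooth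
maps and differentials on an embedded submanifold are described through the ambient manifold:
tangent vectors are velocities of curves inside the subset, a map is smooth if it extends locally
to a smooth map of the ambient manifold, and its differential is that of such an extension. -/

section Subsets

variable {E H M E' H' M' : Type*}
  [NormedAddCommGroup E] [NormedSpace ℝ E] [TopologicalSpace H] (I : ModelWithCorners ℝ E H)
  [TopologicalSpace M] [ChartedSpace H M]
  [NormedAddCommGroup E'] [NormedSpace ℝ E'] [TopologicalSpace H'] (I' : ModelWithCorners ℝ E' H')
  [TopologicalSpace M'] [ChartedSpace H' M']

/-- The vectors `v ∈ T_x M` tangent to the subset `S`: the velocities at time `0` of smooth curves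
in `S` that pass through `x` at time `0`. -/
def subsetTangent (S : Set M) (x : M) : Set (TangentSpace I x) :=
  {v | ∃ c : ℝ → M, (∀ᶠ τ in 𝓝 (0 : ℝ), ContMDiffAt 𝓘(ℝ, ℝ) I ∞ c τ ∧ c τ ∈ S) ∧
    tangentMap 𝓘(ℝ, ℝ) I c ⟨0, (1 : ℝ)⟩ = (⟨x, v⟩ : TangentBundle I M)}

/-- `F` is smooth near `x` and agrees near `x` with `f` on the subset `S`. -/
def IsSmoothExtensionAt (f : M → M') (S : Set M) (x : M) (F : M → M') : Prop :=
  ∃ U : Set M, IsOpen U ∧ x ∈ U ∧ ContMDiffOn I I' ∞ F U ∧ EqOn F f (S ∩ U)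

/-- Smoothness of a map on a subset: local extendability to smooth maps. -/
def IsSmoothOnSubset (f : M → M') (S : Set M) : Prop :=
  ∀ x ∈ S, ∃ F, IsSmoothExtensionAt I I' f S x F

open Classical in
/-- The differential at `x ∈ S` of a map `f` that is smooth on `S`: the differential of any local
smooth extension `F` of `f` (note `F x = f x`). It is meant to be evaluated on vectors tangent to
`S`, where it does not depend on the extension, see `subsetDeriv_eq`. -/
def subsetDeriv (f : M → M') (S : Set M) (x : M) :
    TangentSpace I x →L[ℝ] TangentSpace I' (f x) :=
  if h : ∃ F, IsSmoothExtensionAt I I' f S x F then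
    (mfderiv I I' h.choose x : E →L[ℝ] E')
  else 0

variable {I I'}

theorem mfderiv_eq_of_isSmoothExtensionAt {f F₁ F₂ : M → M'} {S : Set M} {x : M}
    (h₁ : IsSmoothExtensionAt I I' f S x F₁) (h₂ : IsSmoothExtensionAt I I' f S x F₂)
    {v : TangentSpace I x} (hv : v ∈ subsetTangent I S x) :
    (mfderiv I I' F₁ x v : E') = (mfderiv I I' F₂ x v : E') := by
  obtain ⟨c, hc, hcv⟩ := hv
  obtain ⟨U₁, hU₁, hx₁, hF₁, he₁⟩ := h₁
  obtain ⟨U₂, hU₂, hx₂, hF₂, he₂⟩ := h₂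
  have hc0 : c 0 = x := congrArg TotalSpace.proj hcv
  subst hc0
  have hcv' : mfderiv 𝓘(ℝ, ℝ) I c 0 (1 : ℝ) = v := by
    simpa [tangentMap] using hcv
  have hcd : MDifferentiableAt 𝓘(ℝ, ℝ) I c 0 :=
    hc.self_of_nhds.1.mdifferentiableAt (by simp)
  have hd₁ : MDifferentiableAt I I' F₁ (c 0) :=
    ((hF₁ _ hx₁).contMDiffAt (hU₁.mem_nhds hx₁)).mdifferentiableAt (by simp)
  have hd₂ : MDifferentiableAt I I' F₂ (c 0) :=
    ((hF₂ _ hx₂).contMDiffAt (hU₂.mem_nhds hx₂)).mdifferentiableAt (by simp)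
  have hev : F₁ ∘ c =ᶠ[𝓝 0] F₂ ∘ c := by
    filter_upwards [hc, hcd.continuousAt.preimage_mem_nhds (hU₁.mem_nhds hx₁),
      hcd.continuousAt.preimage_mem_nhds (hU₂.mem_nhds hx₂)] with τ h h1 h2
    exact (he₁ ⟨h.2, h1⟩).trans (he₂ ⟨h.2, h2⟩).symm
  have key : (mfderiv 𝓘(ℝ, ℝ) I' (F₁ ∘ c) 0 : ℝ →L[ℝ] E') =
      (mfderiv 𝓘(ℝ, ℝ) I' (F₂ ∘ c) 0 : ℝ →L[ℝ] E') := by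
    have := hev.mfderiv_eq (I := 𝓘(ℝ, ℝ)) (I' := I')
    exact this
  rw [mfderiv_comp 0 hd₁ hcd, mfderiv_comp 0 hd₂ hcd] at key
  have := congrArg (fun L : ℝ →L[ℝ] E' => L 1) key
  rw [← hcv']
  exact this

/-- On vectors tangent to `S`, `subsetDeriv` is the differential of every local extension. -/
theorem subsetDeriv_eq {f F : M → M'} {S : Set M} {x : M}
    (hF : IsSmoothExtensionAt I I' f S x F)
    {v : TangentSpace I x} (hv : v ∈ subsetTangent I S x) :
    (subsetDeriv I I' f S x v : E') = (mfderiv I I' F x v : E') := by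
  have h : ∃ F, IsSmoothExtensionAt I I' f S x F := ⟨F, hF⟩
  have e : subsetDeriv I I' f S x = (mfderiv I I' h.choose x : E →L[ℝ] E') := dif_pos h
  exact (congrArg (fun L : E →L[ℝ] E' => L v) e).trans
    (mfderiv_eq_of_isSmoothExtensionAt h.choose_spec hF hv)

end Subsets

/-! ### The manifold of `1`-jets of maps and its Cartan form -/

section PullbackInstances

variable {B B' : Type*} (f : B' → B) (E : B → Type*) [∀ x, AddCommGroup (E x)]

instance instAddCommGroupPullbackFiber (x : B') : AddCommGroup ((f *ᵖ E) x) :=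
  inferInstanceAs (AddCommGroup (E (f x)))

instance instIsTopologicalAddGroupPullbackFiber [∀ x, TopologicalSpace (E x)]
    [∀ x, IsTopologicalAddGroup (E x)] (x : B') : IsTopologicalAddGroup ((f *ᵖ E) x) :=
  inferInstanceAs (IsTopologicalAddGroup (E (f x)))

instance instContinuousSMulPullbackFiber [∀ x, Module ℝ (E x)] [∀ x, TopologicalSpace (E x)]
    [∀ x, ContinuousSMul ℝ (E x)] (x : B') : ContinuousSMul ℝ ((f *ᵖ E) x) :=
  inferInstanceAs (ContinuousSMul ℝ (E (f x)))

end PullbackInstances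

section Jets

variable (E F M N : Type*)
  [NormedAddCommGroup E] [NormedSpace ℝ E] [TopologicalSpace M] [ChartedSpace E M]
  [IsManifold 𝓘(ℝ, E) ∞ M]
  [NormedAddCommGroup F] [NormedSpace ℝ F] [TopologicalSpace N] [ChartedSpace F N]
  [IsManifold 𝓘(ℝ, F) ∞ N]

/-- The manifold `J¹(M, N)` of `1`-jets of maps `M → N`: the total space of the vector bundle over
`M × N` with fibre `Hom(T_x M, T_y N)` over `(x, y)`. -/
abbrev Jet : Type _ :=
  TotalSpace (E →L[ℝ] F) (fun p : M × N =>
    ((ContMDiffMap.fst : C^∞⟮𝓘(ℝ, E).prod 𝓘(ℝ, F), M × N; 𝓘(ℝ, E), M⟯) *ᵖ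
        (TangentSpace 𝓘(ℝ, E) : M → Type _)) p →L[ℝ]
      ((ContMDiffMap.snd : C^∞⟮𝓘(ℝ, E).prod 𝓘(ℝ, F), M × N; 𝓘(ℝ, F), N⟯) *ᵖ
        (TangentSpace 𝓘(ℝ, F) : N → Type _)) p)

/-- The model with corners of the manifold `Jet E F M N`. -/
abbrev jetModel : ModelWithCorners ℝ ((E × F) × (E →L[ℝ] F))
    (ModelProd (ModelProd E F) (E →L[ℝ] F)) :=
  (𝓘(ℝ, E).prod 𝓘(ℝ, F)).prod 𝓘(ℝ, E →L[ℝ] F)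

instance instIsManifoldJet : IsManifold (jetModel E F) ∞ (Jet E F M N) := inferInstance

variable {E F M N}

namespace Jet

/-- The source `x` of a jet at `x`. -/
def s (j : Jet E F M N) : M := j.proj.1

/-- The target `f x` of the jet of `f` at `x`. -/
def t (j : Jet E F M N) : N := j.proj.2

/-- The differential `T_x M → T_{f x} N` that is the jet of `f` at `x`. -/
def lin (j : Jet E F M N) : TangentSpace 𝓘(ℝ, E) j.s →L[ℝ] TangentSpace 𝓘(ℝ, F) j.t := j.snd

theorem ext_lin {j j' : Jet E F M N} (h₁ : j.s = j'.s) (h₂ : j.t = j'.t)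
    (h₃ : (j.lin : E →L[ℝ] F) = j'.lin) : j = j' := by
  obtain ⟨⟨a, b⟩, L⟩ := j
  obtain ⟨⟨a', b'⟩, L'⟩ := j'
  obtain rfl : a = a' := h₁
  obtain rfl : b = b' := h₂
  obtain rfl : L = L' := h₃
  rfl

/-- The jet with source `x`, target `y` and linear part `L`. -/
def of (x : M) (y : N) (L : TangentSpace 𝓘(ℝ, E) x →L[ℝ] TangentSpace 𝓘(ℝ, F) y) :
    Jet E F M N := ⟨(x, y), L⟩

/-- The `1`-jet of the map `f` at the point `x`. -/
def ofMap (f : M → N) (x : M) : Jet E F M N := of x (f x) (mfderiv 𝓘(ℝ, E) 𝓘(ℝ, F) f x)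

/-- The Cartan form `V ↦ Tt(V) - j ∘ Ts(V)`. -/
def cartanForm (j : Jet E F M N) :
    TangentSpace (jetModel E F) j →L[ℝ] TangentSpace 𝓘(ℝ, F) j.t :=
  mfderiv (jetModel E F) 𝓘(ℝ, F) t j - j.lin ∘L mfderiv (jetModel E F) 𝓘(ℝ, E) s j

/-- Composition `b ∘ a` of jets with `a.t = b.s`. As Mathlib's tangent spaces are by definition the
model space, the equality `T_{a.t} N = T_{b.s} N` is the identity of the model space. -/
def comp {G R : Type*} [NormedAddCommGroup G] [NormedSpace ℝ G] [TopologicalSpace R]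
    [ChartedSpace G R] [IsManifold 𝓘(ℝ, G) ∞ R] (b : Jet F G N R) (a : Jet E F M N) :
    Jet E G M R :=
  of a.s b.t ((b.lin : F →L[ℝ] G) ∘L (a.lin : E →L[ℝ] F))

/-- The inverse of a jet with invertible linear part. -/
def inv (a : Jet E F M N) : Jet F E N M := of a.t a.s (ContinuousLinearMap.inverse a.lin)

end Jet

end Jets

/-! ### Point symmetries of a submersion -/

section PointSymmetries

variable (E F : Type*) {Q X : Type*}
  [NormedAddCommGroup E] [NormedSpace ℝ E] [TopologicalSpace Q] [ChartedSpace E Q]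
  [IsManifold 𝓘(ℝ, E) ∞ Q]
  [NormedAddCommGroup F] [NormedSpace ℝ F] [TopologicalSpace X] [ChartedSpace F X]
  [IsManifold 𝓘(ℝ, F) ∞ X]

/-- The local homeomorphism `φ` is a local diffeomorphism between its source and target. -/
def IsLocalDiffeo (φ : OpenPartialHomeomorph Q Q) : Prop :=
  ContMDiffOn 𝓘(ℝ, E) 𝓘(ℝ, E) ∞ φ φ.source ∧ ContMDiffOn 𝓘(ℝ, E) 𝓘(ℝ, E) ∞ φ.symm φ.target

/-- The local diffeomorphism `φ` of `Q` lifts the local diffeomorphism `ψ` of `X` along `q`. -/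
structure IsLift (q : Q → X) (φ : OpenPartialHomeomorph Q Q) (ψ : OpenPartialHomeomorph X X) :
    Prop where
  diffeo_top : IsLocalDiffeo E φ
  diffeo_base : IsLocalDiffeo F ψ
  mapsTo : MapsTo q φ.source ψ.source
  comm : ∀ x ∈ φ.source, q (φ x) = ψ (q x)

/-- `J¹q` as the space of pointwise splittings `h : T_{q x} X → T_x Q` of `Tq`, inside `J¹(X, Q)`.
The projection `p₁ : J¹q → Q` is `Jet.t` and `π : J¹q → X` is `Jet.s`. -/
def sectionJets (q : Q → X) : Set (Jet F E X Q) :=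
  {j | ∃ (x : Q) (h : TangentSpace 𝓘(ℝ, F) (q x) →L[ℝ] TangentSpace 𝓘(ℝ, E) x),
    mfderiv 𝓘(ℝ, E) 𝓘(ℝ, F) q x ∘L h = ContinuousLinearMap.id ℝ _ ∧ j = Jet.of (q x) x h}

/-- `J¹Diff_loc(q)`: the `1`-jets of local diffeomorphisms of `Q` that lift a local
diffeomorphism of `X`, inside `J¹(Q, Q)`. -/
def pointJets (q : Q → X) : Set (Jet E E Q Q) :=
  {g | ∃ (φ : OpenPartialHomeomorph Q Q) (ψ : OpenPartialHomeomorph X X) (x : Q),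
    IsLift E F q φ ψ ∧ x ∈ φ.source ∧ g = Jet.ofMap φ x}

open Classical in
/-- The groupoid morphism `q̄ : J¹Diff_loc(q) → J¹Diff_loc(X)` sending the jet of `φ` at `x` to the
jet at `q x` of a diffeomorphism lifted by `φ` (set to the unit jet outside `J¹Diff_loc(q)`). -/
def baseJet (q : Q → X) (g : Jet E E Q Q) : Jet F F X X :=
  if h : ∃ (ψ : OpenPartialHomeomorph X X) (φ : OpenPartialHomeomorph Q Q) (x : Q),
      IsLift E F q φ ψ ∧ x ∈ φ.source ∧ g = Jet.ofMap φ x then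
    Jet.ofMap h.choose (q g.s)
  else Jet.ofMap id (q g.s)

variable {E F}

/-- `baseJet` does not depend on the choice of representatives. -/
theorem baseJet_ofMap {q : Q → X} (hq : ContMDiff 𝓘(ℝ, E) 𝓘(ℝ, F) ∞ q)
    (hs : ∀ x, Function.Surjective (mfderiv 𝓘(ℝ, E) 𝓘(ℝ, F) q x))
    {φ : OpenPartialHomeomorph Q Q} {ψ : OpenPartialHomeomorph X X}
    (hl : IsLift E F q φ ψ) {x : Q} (hx : x ∈ φ.source) :
    baseJet E F q (Jet.ofMap φ x : Jet E E Q Q) = Jet.ofMap ψ (q x) := by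
  have h : ∃ (ψ' : OpenPartialHomeomorph X X) (φ' : OpenPartialHomeomorph Q Q) (x' : Q),
      IsLift E F q φ' ψ' ∧ x' ∈ φ'.source ∧
        (Jet.ofMap φ x : Jet E E Q Q) = Jet.ofMap φ' x' := ⟨ψ, φ, x, hl, hx, rfl⟩
  unfold baseJet
  rw [dif_pos h]
  obtain ⟨φ', x', hl', hx', he⟩ := h.choose_spec
  generalize h.choose = ψ' at *
  clear h
  have hxx : x = x' := congrArg (fun j : Jet E E Q Q => j.s) he
  subst hxx
  have hφ : φ x = φ' x := congrArg (fun j : Jet E E Q Q => j.t) he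
  have hL : (mfderiv 𝓘(ℝ, E) 𝓘(ℝ, E) φ x : E →L[ℝ] E) =
      (mfderiv 𝓘(ℝ, E) 𝓘(ℝ, E) φ' x : E →L[ℝ] E) :=
    congrArg (β := E →L[ℝ] E) (fun j : Jet E E Q Q => j.lin) he
  have hψ : ψ' (q x) = ψ (q x) := by rw [← hl'.comm x hx', ← hl.comm x hx, hφ]
  have aux : ∀ {φ₀ : OpenPartialHomeomorph Q Q} {ψ₀ : OpenPartialHomeomorph X X},
      IsLift E F q φ₀ ψ₀ → x ∈ φ₀.source →
      (mfderiv 𝓘(ℝ, E) 𝓘(ℝ, F) q (φ₀ x) : E →L[ℝ] F) ∘L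
        (mfderiv 𝓘(ℝ, E) 𝓘(ℝ, E) φ₀ x : E →L[ℝ] E) =
      (mfderiv 𝓘(ℝ, F) 𝓘(ℝ, F) ψ₀ (q x) : F →L[ℝ] F) ∘L
        (mfderiv 𝓘(ℝ, E) 𝓘(ℝ, F) q x : E →L[ℝ] F) := by
    intro φ₀ ψ₀ h₀ hx₀
    have hqd : ∀ y, MDifferentiableAt 𝓘(ℝ, E) 𝓘(ℝ, F) q y := fun y =>
      (hq y).mdifferentiableAt (by simp)
    have hφd : MDifferentiableAt 𝓘(ℝ, E) 𝓘(ℝ, E) φ₀ x :=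
      ((h₀.diffeo_top.1 x hx₀).contMDiffAt (φ₀.open_source.mem_nhds hx₀)).mdifferentiableAt
        (by simp)
    have hψd : MDifferentiableAt 𝓘(ℝ, F) 𝓘(ℝ, F) ψ₀ (q x) :=
      ((h₀.diffeo_base.1 _ (h₀.mapsTo hx₀)).contMDiffAt
        (ψ₀.open_source.mem_nhds (h₀.mapsTo hx₀))).mdifferentiableAt (by simp)
    have hev : q ∘ φ₀ =ᶠ[𝓝 x] ψ₀ ∘ q := by
      filter_upwards [φ₀.open_source.mem_nhds hx₀] with y hy using h₀.comm y hy
    have := hev.mfderiv_eq (I := 𝓘(ℝ, E)) (I' := 𝓘(ℝ, F))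
    rw [mfderiv_comp x (hqd _) hφd, mfderiv_comp x hψd (hqd _)] at this
    exact this
  have h1 := aux hl hx
  have h2 := aux hl' hx'
  have h3 : (mfderiv 𝓘(ℝ, F) 𝓘(ℝ, F) ψ' (q x) : F →L[ℝ] F) =
      (mfderiv 𝓘(ℝ, F) 𝓘(ℝ, F) ψ (q x) : F →L[ℝ] F) := by
    rw [← hφ, ← hL, h1] at h2
    ext w
    obtain ⟨v, rfl⟩ := hs x w
    exact (DFunLike.congr_fun h2 v).symm
  change Jet.ofMap ψ' (q x) = Jet.ofMap ψ (q x)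
  exact Jet.ext_lin rfl hψ h3

variable (E F)

/-- The arrows of the action groupoid `J¹Diff_loc(q) ⋉ J¹q`: pairs `(g, h)` with `s(g) = p₁(h)`. -/
def actionSpace (q : Q → X) : Set (Jet E E Q Q × Jet F E X Q) :=
  {a | a.1 ∈ pointJets E F q ∧ a.2 ∈ sectionJets E F q ∧ a.1.s = a.2.t}

/-- The model with corners of the manifold `J¹(Q, Q) × J¹(X, Q)`. -/
abbrev actionModel := (jetModel E E).prod (jetModel F E)

variable {E F}

/-- The action map `m(g, h) = g · h = Tφ ∘ h ∘ (Tφ̄)⁻¹`, where `g` is the jet of `φ` and `φ`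
lifts `φ̄`. -/
def jetAction (q : Q → X) (a : Jet E E Q Q × Jet F E X Q) : Jet F E X Q :=
  (a.1.comp a.2).comp (baseJet E F q a.1).inv

/-- The differential at `g` of `q̄ : J¹Diff_loc(q) → J¹Diff_loc(X)`. -/
def baseJetDeriv (q : Q → X) (g : Jet E E Q Q) :
    TangentSpace (jetModel E E) g →L[ℝ] TangentSpace (jetModel F F) (baseJet E F q g) :=
  subsetDeriv (jetModel E E) (jetModel F F) (baseJet E F q) (pointJets E F q) g

/-- The differential at `a = (g, h)` of a map `m : J¹Diff_loc(q) ⋉ J¹q → J¹q`. -/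
def actionDeriv (q : Q → X) (m : Jet E E Q Q × Jet F E X Q → Jet F E X Q)
    (a : Jet E E Q Q × Jet F E X Q) :
    TangentSpace (actionModel E F) a →L[ℝ] TangentSpace (jetModel F E) (m a) :=
  subsetDeriv (actionModel E F) (jetModel F E) m (actionSpace E F q) a

/-- The tangent vectors `(W, V)` of `J¹Diff_loc(q) ⋉ J¹q` at `a = (g, h)`: as `s` and `p₁` are
submersions, these are the pairs of tangent vectors with `Ts(W) = Tp₁(V)`. -/
def actionTangent (q : Q → X) (a : Jet E E Q Q × Jet F E X Q) :
    Set (TangentSpace (actionModel E F) a) :=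
  subsetTangent (actionModel E F) (actionSpace E F q) a

/-- The differential `(W, V) ↦ W` of the projection to `J¹Diff_loc(q)`. -/
def prG (a : Jet E E Q Q × Jet F E X Q) :
    TangentSpace (actionModel E F) a →L[ℝ] TangentSpace (jetModel E E) a.1 :=
  mfderiv (actionModel E F) (jetModel E E) Prod.fst a

/-- The differential `(W, V) ↦ V` of the projection to `J¹q`. -/
def prP (a : Jet E E Q Q × Jet F E X Q) :
    TangentSpace (actionModel E F) a →L[ℝ] TangentSpace (jetModel F E) a.2 :=
  mfderiv (actionModel E F) (jetModel F E) Prod.snd a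

/-- `m` is a smooth action of the groupoid `J¹Diff_loc(q) ⇉ Q` on `J¹q` along `p₁`. -/
structure IsSmoothGroupoidAction (q : Q → X)
    (m : Jet E E Q Q × Jet F E X Q → Jet F E X Q) : Prop where
  smooth : IsSmoothOnSubset (actionModel E F) (jetModel F E) m (actionSpace E F q)
  mapsTo : ∀ a ∈ actionSpace E F q, m a ∈ sectionJets E F q
  moment : ∀ a ∈ actionSpace E F q, (m a).t = a.1.t
  unit_mem : ∀ x : Q, (Jet.ofMap id x : Jet E E Q Q) ∈ pointJets E F q
  inv_mem : ∀ g ∈ pointJets E F q, g.inv ∈ pointJets E F q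
  mul_mem : ∀ g₁ ∈ pointJets E F q, ∀ g₂ ∈ pointJets E F q,
    g₁.s = g₂.t → g₁.comp g₂ ∈ pointJets E F q
  unit_act : ∀ h ∈ sectionJets E F q, m (Jet.ofMap id h.t, h) = h
  mul_act : ∀ g₁ ∈ pointJets E F q, ∀ a ∈ actionSpace E F q, g₁.s = a.1.t →
    m (g₁.comp a.1, a.2) = m (g₁, m a)

/-- The Pfaffian distribution `ker ω_Q ⊆ T J¹Diff_loc(q)` at `g`. -/
def groupoidDistribution (q : Q → X) (g : Jet E E Q Q) : Set (TangentSpace (jetModel E E) g) :=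
  {W | W ∈ subsetTangent (jetModel E E) (pointJets E F q) g ∧ g.cartanForm W = 0}

/-- The Pfaffian distribution `C = ker θ_Q ⊆ T J¹q` at `h`. -/
def sectionDistribution (q : Q → X) (h : Jet F E X Q) : Set (TangentSpace (jetModel F E) h) :=
  {V | V ∈ subsetTangent (jetModel F E) (sectionJets E F q) h ∧ h.cartanForm V = 0}

/-- The distribution `C^π = C ∩ ker Tπ ⊆ T J¹q` at `h`. -/
def verticalDistribution (q : Q → X) (h : Jet F E X Q) : Set (TangentSpace (jetModel F E) h) :=
  {V | V ∈ sectionDistribution q h ∧ mfderiv (jetModel F E) 𝓘(ℝ, F) Jet.s h V = 0}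

/-- The form `pr^* ω_Q` at `a = (g, h)`, with values in `T_{t(g)} Q`. -/
def prOmega (a : Jet E E Q Q × Jet F E X Q) :
    TangentSpace (actionModel E F) a →L[ℝ] TangentSpace 𝓘(ℝ, E) a.1.t :=
  a.1.cartanForm ∘L prG a

/-- The form `(g · h) ∘ (q̄^* ω_X)` at `a = (g, h)`, where `ω_X` is the Cartan form of
`J¹Diff_loc(X)` and `g · h` is regarded as a splitting `T_{q(t(g))} X → T_{t(g)} Q`. -/
def twistOmega (q : Q → X) (a : Jet E E Q Q × Jet F E X Q) :
    TangentSpace (actionModel E F) a →L[ℝ] TangentSpace 𝓘(ℝ, E) a.1.t :=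
  ((jetAction q a).lin : F →L[ℝ] E) ∘L
    (((baseJet E F q a.1).cartanForm ∘L (baseJetDeriv q a.1 ∘L prG a) :
      TangentSpace (actionModel E F) a →L[ℝ] F))

/-- The form `m^* θ_Q` at `a = (g, h)`. Its values are in `T_{p₁(m(g, h))} Q`, where
`p₁(m(g, h)) = t(g)` for an action `m` along `p₁`. -/
def actionTheta (q : Q → X) (m : Jet E E Q Q × Jet F E X Q → Jet F E X Q)
    (a : Jet E E Q Q × Jet F E X Q) :
    TangentSpace (actionModel E F) a →L[ℝ] TangentSpace 𝓘(ℝ, E) a.1.t :=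
  ((m a).cartanForm ∘L actionDeriv q m a : TangentSpace (actionModel E F) a →L[ℝ] E)

/-- The form `g · (pr^* θ_Q)` at `a = (g, h)`, where `p₁(h) = s(g)` and where
`g = j¹_x φ` acts by `T_x φ : T_{s(g)} Q → T_{t(g)} Q`. -/
def prTheta (a : Jet E E Q Q × Jet F E X Q) :
    TangentSpace (actionModel E F) a →L[ℝ] TangentSpace 𝓘(ℝ, E) a.1.t :=
  (a.1.lin : E →L[ℝ] E) ∘L
    (a.2.cartanForm ∘L prP a : TangentSpace (actionModel E F) a →L[ℝ] E)

/-- The defining identity `pr^* ω_Q = m^* θ_Q - g · (pr^* θ_Q)` of a Pfaffian action, for the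
action map `m`, with the coefficients `ker Tq` of `θ_Q` included in the representation `TQ` of
`J¹Diff_loc(q)` in which `ω_Q` has its values. -/
def IsPfaffianAction (q : Q → X) (m : Jet E E Q Q × Jet F E X Q → Jet F E X Q) : Prop :=
  ∀ a ∈ actionSpace E F q, ∀ v ∈ actionTangent q a,
    prOmega a v = actionTheta q m a v - prTheta a v

/-- The action `m` is by Pfaffian symmetries: `Tm` maps `ker ω_Q ×_{TQ} C` to `C` and
`ker ω_Q ×_{TQ} C^π` to `C^π`. Here `ker ω_Q ×_{TQ} C` consists of the tangent vectors `(W, V)`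
of `J¹Diff_loc(q) ⋉ J¹q` with `W ∈ ker ω_Q` and `V ∈ C`. -/
structure IsActionByPfaffianSymmetries (q : Q → X)
    (m : Jet E E Q Q × Jet F E X Q → Jet F E X Q) : Prop where
  action : IsSmoothGroupoidAction q m
  internal : ∀ a ∈ actionSpace E F q, ∀ v ∈ actionTangent q a,
    prG a v ∈ groupoidDistribution (F := F) q a.1 → prP a v ∈ sectionDistribution q a.2 →
      actionDeriv q m a v ∈ sectionDistribution q (m a)
  vertical : ∀ a ∈ actionSpace E F q, ∀ v ∈ actionTangent q a,
    prG a v ∈ groupoidDistribution (F := F) q a.1 → prP a v ∈ verticalDistribution q a.2 →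
      actionDeriv q m a v ∈ verticalDistribution q (m a)

end PointSymmetries

end

set_option linter.unusedSectionVars false

/-! Fix a tangent vector v of the action groupoid at (g, h), and write S = Ts(v), T = Tt(v), with ḡ
the base jet of g. A Cartan form sees a tangent vector of a jet space only through its source and
target components, never through the variation of the linear part. So it suffices to differentiate
relations between base points: p₁(h) = s(g), π(h) = q(s(g)), p₁(m) = t, π(m) = q ∘ t, s(q̄) = q ∘ s,
t(q̄) = q ∘ t. They give pr^*ω_Q = T - gS, twist = (g·h)(Tq T - ḡ Tq S), m^*θ_Q = T - (g·h) Tq T,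
g·pr^*θ_Q = gS - g h Tq S. The identity (1) is then linear algebra from (g·h) ∘ ḡ = g ∘ h
(`prOmega_sub_twistOmega`).

The relation ḡ ∘ Tq = Tq ∘ g (`baseJet_comp`) turns the twist into (g·h) ∘ Tq applied to ω_Q
(`twistOmega_eq_comp_prOmega`). It therefore vanishes on ker ω_Q, and (3) follows from (1). The
twist itself does not vanish: jets at a fixed point of translations in charts adapted to q move the
target transversally to the fibres while S = 0, and g·h is injective. This is (2).

Smoothness of q̄ and of m on the jet subsets is shown by explicit local extensions. The jet q̄(g)
equals Tq ∘ g ∘ σ for a smooth local splitting σ of Tq. The extension of m inserts auxiliary jets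
that join the base points where they no longer match off the action space. -/

noncomputable section

/-! ### Frames of the tangent bundle over a chart. -/

section TangentFrames

variable {E M : Type*} [NormedAddCommGroup E] [NormedSpace ℝ E] [TopologicalSpace M]
  [ChartedSpace E M] [IsManifold 𝓘(ℝ, E) ∞ M]

/-- The trivialization of the tangent bundle over the preferred chart at `a`, as a linear map from
`T_x M` to the model space. -/
def toFrame (a x : M) : E →L[ℝ] E :=
  (trivializationAt E (TangentSpace 𝓘(ℝ, E)) a).continuousLinearMapAt ℝ x

/-- The inverse of `toFrame`. -/
def ofFrame (a x : M) : E →L[ℝ] E :=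
  (trivializationAt E (TangentSpace 𝓘(ℝ, E)) a).symmL ℝ x

theorem toFrame_ofFrame {a x : M} (hx : x ∈ (chartAt E a).source) (v : E) :
    toFrame a x (ofFrame a x v) = v :=
  (trivializationAt E (TangentSpace 𝓘(ℝ, E)) a).continuousLinearMapAt_symmL (R := ℝ) hx v

theorem ofFrame_toFrame {a x : M} (hx : x ∈ (chartAt E a).source) (v : E) :
    ofFrame a x (toFrame a x v) = v :=
  (trivializationAt E (TangentSpace 𝓘(ℝ, E)) a).symmL_continuousLinearMapAt (R := ℝ) hx v

theorem toFrame_comp_ofFrame {a x : M} (hx : x ∈ (chartAt E a).source) :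
    toFrame a x ∘L ofFrame a x = ContinuousLinearMap.id ℝ E :=
  ContinuousLinearMap.ext (toFrame_ofFrame hx)

theorem ofFrame_comp_toFrame {a x : M} (hx : x ∈ (chartAt E a).source) :
    ofFrame a x ∘L toFrame a x = ContinuousLinearMap.id ℝ E :=
  ContinuousLinearMap.ext (ofFrame_toFrame hx)

theorem isInvertible_toFrame {a x : M} (hx : x ∈ (chartAt E a).source) :
    (toFrame (E := E) a x).IsInvertible :=
  .of_inverse (toFrame_comp_ofFrame hx) (ofFrame_comp_toFrame hx)

theorem isInvertible_ofFrame {a x : M} (hx : x ∈ (chartAt E a).source) :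
    (ofFrame (E := E) a x).IsInvertible :=
  .of_inverse (ofFrame_comp_toFrame hx) (toFrame_comp_ofFrame hx)

theorem inverse_toFrame {a x : M} (hx : x ∈ (chartAt E a).source) :
    (toFrame (E := E) a x).inverse = ofFrame a x :=
  ContinuousLinearMap.inverse_eq (toFrame_comp_ofFrame hx) (ofFrame_comp_toFrame hx)

theorem inverse_ofFrame {a x : M} (hx : x ∈ (chartAt E a).source) :
    (ofFrame (E := E) a x).inverse = toFrame a x :=
  ContinuousLinearMap.inverse_eq (ofFrame_comp_toFrame hx) (toFrame_comp_ofFrame hx)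

end TangentFrames

/-! ### Smoothness in jet spaces, read in frames. -/

namespace Jet

variable {E F M N : Type*}
  [NormedAddCommGroup E] [NormedSpace ℝ E] [TopologicalSpace M] [ChartedSpace E M]
  [IsManifold 𝓘(ℝ, E) ∞ M]
  [NormedAddCommGroup F] [NormedSpace ℝ F] [TopologicalSpace N] [ChartedSpace F N]
  [IsManifold 𝓘(ℝ, F) ∞ N]

/-- The linear part of a jet, as a map of the model spaces. -/
def linear (j : Jet E F M N) : E →L[ℝ] F := j.lin

/-- The jet with a given linear part, as a map of the model spaces. -/
def ofLinear (x : M) (y : N) (A : E →L[ℝ] F) : Jet E F M N := of x y A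

/-- The linear part of a jet, read in the preferred charts at `a` and `b`. -/
def coord (a : M) (b : N) (j : Jet E F M N) : E →L[ℝ] F :=
  toFrame b j.t ∘L j.linear ∘L ofFrame a j.s

/-- A trivialization of a pulled-back bundle is the original one at the image point, so the
Hom-bundle trivialization is conjugation by the two tangent frames. This is what reduces smoothness
of jets to smoothness of maps into a fixed space of linear maps. -/
theorem trivializationAt_snd {a : M} {b : N} {j : Jet E F M N}
    (hs : j.s ∈ (chartAt E a).source) (ht : j.t ∈ (chartAt F b).source) :
    (trivializationAt (E →L[ℝ] F) (fun p : M × N =>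
    ((ContMDiffMap.fst : C^∞⟮𝓘(ℝ, E).prod 𝓘(ℝ, F), M × N; 𝓘(ℝ, E), M⟯) *ᵖ
        (TangentSpace 𝓘(ℝ, E) : M → Type _)) p →L[ℝ]
      ((ContMDiffMap.snd : C^∞⟮𝓘(ℝ, E).prod 𝓘(ℝ, F), M × N; 𝓘(ℝ, F), N⟯) *ᵖ
        (TangentSpace 𝓘(ℝ, F) : N → Type _)) p) (a, b) j).2 = j.coord a b := by
  rw [hom_trivializationAt_apply]
  set e₁ := trivializationAt E ((ContMDiffMap.fst : C^∞⟮𝓘(ℝ, E).prod 𝓘(ℝ, F), M × N; 𝓘(ℝ, E), M⟯) *ᵖ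
        (TangentSpace 𝓘(ℝ, E) : M → Type _)) (a, b) with he₁
  set e₂ := trivializationAt F ((ContMDiffMap.snd : C^∞⟮𝓘(ℝ, E).prod 𝓘(ℝ, F), M × N; 𝓘(ℝ, F), N⟯) *ᵖ
        (TangentSpace 𝓘(ℝ, F) : N → Type _)) (a, b) with he₂
  have hb₁ : j.proj ∈ e₁.baseSet := hs
  have hb₂ : j.proj ∈ e₂.baseSet := ht
  have h₁ : ∀ v, e₁.continuousLinearMapAt ℝ j.proj v = toFrame (E := E) a j.s v := by
    intro v
    have hs' : j.s ∈ (trivializationAt E (TangentSpace 𝓘(ℝ, E)) a).baseSet := hs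
    exact (congrFun (Trivialization.coe_linearMapAt_of_mem e₁ hb₁) v).trans
      (congrFun (Trivialization.coe_linearMapAt_of_mem _ hs') v).symm
  have h₂ : ∀ v, e₂.continuousLinearMapAt ℝ j.proj v = toFrame (E := F) b j.t v := by
    intro v
    have ht' : j.t ∈ (trivializationAt F (TangentSpace 𝓘(ℝ, F)) b).baseSet := ht
    exact (congrFun (Trivialization.coe_linearMapAt_of_mem e₂ hb₂) v).trans
      (congrFun (Trivialization.coe_linearMapAt_of_mem _ ht') v).symm
  -- The two inverses agree because the maps that they invert agree, by `h₁`.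
  have h₃ : ∀ v, e₁.symmL ℝ j.proj v = ofFrame (E := E) a j.s v := by
    intro v
    have := e₁.symmL_continuousLinearMapAt (R := ℝ) hb₁ (ofFrame (E := E) a j.s v)
    exact (congrArg (e₁.symmL ℝ j.proj)
      ((h₁ (ofFrame (E := E) a j.s v)).trans (toFrame_ofFrame hs v))).symm.trans this
  ext v
  change e₂.continuousLinearMapAt ℝ j.proj (j.snd (e₁.symmL ℝ j.proj v)) = _
  rw [h₂, h₃]
  rfl

variable {E' H' M' : Type*} [NormedAddCommGroup E'] [NormedSpace ℝ E'] [TopologicalSpace H']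
  {I' : ModelWithCorners ℝ E' H'} [TopologicalSpace M'] [ChartedSpace H' M']

theorem contMDiff_s : ContMDiff (jetModel E F) 𝓘(ℝ, E) ∞ (s : Jet E F M N → M) :=
  contMDiff_fst.comp (contMDiff_proj _)

theorem contMDiff_t : ContMDiff (jetModel E F) 𝓘(ℝ, F) ∞ (t : Jet E F M N → N) :=
  contMDiff_snd.comp (contMDiff_proj _)

/-- Smoothness of a map to a jet space, read in charts. -/
theorem contMDiffAt_iff {f : M' → Jet E F M N} {x : M'} {a : M} {b : N}
    (hs : (f x).s ∈ (chartAt E a).source) (ht : (f x).t ∈ (chartAt F b).source) :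
    ContMDiffAt I' (jetModel E F) ∞ f x ↔ ContMDiffAt I' 𝓘(ℝ, E) ∞ (fun y => (f y).s) x ∧
      ContMDiffAt I' 𝓘(ℝ, F) ∞ (fun y => (f y).t) x ∧
      ContMDiffAt I' 𝓘(ℝ, E →L[ℝ] F) ∞ (fun y => (f y).coord a b) x := by
  have key := Trivialization.contMDiffAt_iff (n := ∞) (IM := I') (IB := 𝓘(ℝ, E).prod 𝓘(ℝ, F))
    (f := f) (x₀ := x)
    (e := trivializationAt (E →L[ℝ] F) (fun p : M × N =>
    ((ContMDiffMap.fst : C^∞⟮𝓘(ℝ, E).prod 𝓘(ℝ, F), M × N; 𝓘(ℝ, E), M⟯) *ᵖ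
        (TangentSpace 𝓘(ℝ, E) : M → Type _)) p →L[ℝ]
      ((ContMDiffMap.snd : C^∞⟮𝓘(ℝ, E).prod 𝓘(ℝ, F), M × N; 𝓘(ℝ, F), N⟯) *ᵖ
        (TangentSpace 𝓘(ℝ, F) : N → Type _)) p) (a, b))
    (by rw [Trivialization.mem_source]; exact ⟨hs, ht⟩)
  have hp : ContMDiffAt I' (𝓘(ℝ, E).prod 𝓘(ℝ, F)) ∞ (fun y => (f y).proj) x ↔
      ContMDiffAt I' 𝓘(ℝ, E) ∞ (fun y => (f y).s) x ∧
      ContMDiffAt I' 𝓘(ℝ, F) ∞ (fun y => (f y).t) x :=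
    contMDiffAt_prod_iff _
  rw [key, hp, and_assoc]
  refine and_congr_right fun h₁ => and_congr_right fun h₂ => ?_
  refine Filter.EventuallyEq.contMDiffAt_iff ?_
  filter_upwards [h₁.continuousAt.preimage_mem_nhds ((chartAt E a).open_source.mem_nhds hs),
    h₂.continuousAt.preimage_mem_nhds ((chartAt F b).open_source.mem_nhds ht)] with y hy₁ hy₂
  exact trivializationAt_snd hy₁ hy₂

/-- In frames this is composition of linear maps: the two frames in the middle cancel. The
cancellation needs the middle base points to agree on a whole neighbourhood, not just at x. -/
theorem contMDiffAt_comp {G R : Type*} [NormedAddCommGroup G] [NormedSpace ℝ G]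
    [TopologicalSpace R] [ChartedSpace G R] [IsManifold 𝓘(ℝ, G) ∞ R]
    {f : M' → Jet E F M N} {g : M' → Jet F G N R} {x : M'}
    (hg : ContMDiffAt I' (jetModel F G) ∞ g x) (hf : ContMDiffAt I' (jetModel E F) ∞ f x)
    (h : ∀ᶠ y in 𝓝 x, (g y).s = (f y).t) :
    ContMDiffAt I' (jetModel E G) ∞ (fun y => (g y).comp (f y)) x := by
  have hx := h.self_of_nhds
  have hf' := (contMDiffAt_iff (mem_chart_source E (f x).s) (mem_chart_source F (f x).t)).1 hf
  have hg' := (contMDiffAt_iff (a := (g x).s) (mem_chart_source F _)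
    (mem_chart_source G (g x).t)).1 hg
  rw [hx] at hg'
  refine (contMDiffAt_iff (a := (f x).s) (b := (g x).t) (mem_chart_source E _)
    (mem_chart_source G _)).2 ⟨hf'.1, hg'.2.1, (hg'.2.2.clm_comp hf'.2.2).congr_of_eventuallyEq ?_⟩
  filter_upwards [h, hf'.2.1.continuousAt.preimage_mem_nhds
    ((chartAt F (f x).t).open_source.mem_nhds (mem_chart_source F _))] with y hy hy'
  ext v
  change _ = toFrame (g x).t (g y).t ((g y).linear (ofFrame (f x).t (g y).s
    (toFrame (f x).t (f y).t ((f y).linear (ofFrame (f x).s (f y).s v)))))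
  rw [hy, ofFrame_toFrame hy']
  rfl

/-- Conjugation by invertible frames commutes with `ContinuousLinearMap.inverse`, even at
non-invertible maps, and inversion is smooth at an invertible map of a complete space. Invertibility
is thus needed only at x. -/
theorem contMDiffAt_inv [CompleteSpace E] {f : M' → Jet E F M N} {x : M'}
    (hf : ContMDiffAt I' (jetModel E F) ∞ f x)
    (h : (f x).linear.IsInvertible) :
    ContMDiffAt I' (jetModel F E) ∞ (fun y => (f y).inv) x := by
  have hf' := (contMDiffAt_iff (mem_chart_source E (f x).s) (mem_chart_source F (f x).t)).1 hf
  have hinv : ∀ y, (f y).s ∈ (chartAt E (f x).s).source → (f y).t ∈ (chartAt F (f x).t).source →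
      ((f y).coord (f x).s (f x).t).inverse = (f y).inv.coord (f x).t (f x).s ∧
      ((f y).linear.IsInvertible → ((f y).coord (f x).s (f x).t).IsInvertible) := by
    intro y hs ht
    have h₁ := isInvertible_toFrame ht
    have h₂ := isInvertible_ofFrame hs
    refine ⟨?_, fun h => h₁.comp (h.comp h₂)⟩
    rw [coord, h₁.inverse_comp_of_left, h₂.inverse_comp_of_right, inverse_toFrame ht,
      inverse_ofFrame hs, ContinuousLinearMap.comp_assoc]
    rfl
  have hx := hinv x (mem_chart_source E _) (mem_chart_source F _)
  refine (contMDiffAt_iff (a := (f x).t) (b := (f x).s) (mem_chart_source F _)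
    (mem_chart_source E _)).2 ⟨hf'.2.1, hf'.1, ?_⟩
  refine (((hx.2 h).contDiffAt_map_inverse (n := ∞)).contMDiffAt.comp x
    hf'.2.2).congr_of_eventuallyEq ?_
  filter_upwards [hf'.1.continuousAt.preimage_mem_nhds
      ((chartAt E (f x).s).open_source.mem_nhds (mem_chart_source E _)),
    hf'.2.1.continuousAt.preimage_mem_nhds
      ((chartAt F (f x).t).open_source.mem_nhds (mem_chart_source F _))] with y hs ht
  exact (hinv y hs ht).1.symm

/-- The jet that is the constant linear map `A` in the preferred charts at `a` and `b`. -/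
def ofFrames (a : M) (b : N) (A : E →L[ℝ] F) (p : M × N) : Jet E F M N :=
  ofLinear p.1 p.2 (ofFrame b p.2 ∘L A ∘L toFrame a p.1)

theorem contMDiffAt_ofFrames (a : M) (b : N) (A : E →L[ℝ] F) {f : M' → M} {g : M' → N} {x : M'}
    (hf : ContMDiffAt I' 𝓘(ℝ, E) ∞ f x) (hg : ContMDiffAt I' 𝓘(ℝ, F) ∞ g x)
    (ha : f x ∈ (chartAt E a).source) (hb : g x ∈ (chartAt F b).source) :
    ContMDiffAt I' (jetModel E F) ∞ (fun y => ofFrames a b A (f y, g y)) x := by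
  refine (contMDiffAt_iff (a := a) (b := b) ha hb).2 ⟨hf, hg,
    (contMDiffAt_const (c := A)).congr_of_eventuallyEq ?_⟩
  filter_upwards [hf.continuousAt.preimage_mem_nhds ((chartAt E a).open_source.mem_nhds ha),
    hg.continuousAt.preimage_mem_nhds ((chartAt F b).open_source.mem_nhds hb)] with y hy₁ hy₂
  ext v
  change toFrame b (g y) (ofFrame b (g y) (A (toFrame a (f y) (ofFrame a (f y) v)))) = A v
  rw [toFrame_ofFrame hy₁, toFrame_ofFrame hy₂]

/-- The map may depend on a parameter. The fixed case gives the jet of q as a smooth function of the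
point; the parametrized case gives smooth curves of jets of translations at one point. -/
theorem contMDiffAt_ofMap {E' M' : Type*} [NormedAddCommGroup E'] [NormedSpace ℝ E']
    [TopologicalSpace M'] [ChartedSpace E' M'] [IsManifold 𝓘(ℝ, E') ∞ M']
    {f : M' → M → N} {g : M' → M} {x : M'}
    (hf : ContMDiffAt (𝓘(ℝ, E').prod 𝓘(ℝ, E)) 𝓘(ℝ, F) ∞ (Function.uncurry f) (x, g x))
    (hg : ContMDiffAt 𝓘(ℝ, E') 𝓘(ℝ, E) ∞ g x) :
    ContMDiffAt 𝓘(ℝ, E') (jetModel E F) ∞ (fun y => (ofMap (f y) (g y) : Jet E F M N)) x := by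
  have := IsManifold.of_le (I := 𝓘(ℝ, E')) (M := M') (m := 1) (n := ∞) (by simp)
  have hfg : ContMDiffAt 𝓘(ℝ, E') 𝓘(ℝ, F) ∞ (fun y => f y (g y)) x :=
    ContMDiffAt.comp (g := Function.uncurry f) (f := fun y => (y, g y)) x hf
      (contMDiffAt_id.prodMk hg)
  refine (contMDiffAt_iff (a := g x) (b := f x (g x)) (mem_chart_source E _)
    (mem_chart_source F _)).2 ⟨hg, hfg, hf.mfderiv f g hg (by simp)⟩

end Jet

/-! ### Differential calculus on subsets. -/

section SubsetCalculus

variable {E H M E' H' M' E'' H'' M'' : Type*}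
  [NormedAddCommGroup E] [NormedSpace ℝ E] [TopologicalSpace H] {I : ModelWithCorners ℝ E H}
  [TopologicalSpace M] [ChartedSpace H M]
  [NormedAddCommGroup E'] [NormedSpace ℝ E'] [TopologicalSpace H'] {I' : ModelWithCorners ℝ E' H'}
  [TopologicalSpace M'] [ChartedSpace H' M']
  [NormedAddCommGroup E''] [NormedSpace ℝ E''] [TopologicalSpace H'']
  {I'' : ModelWithCorners ℝ E'' H''} [TopologicalSpace M''] [ChartedSpace H'' M'']

/-- Maps that agree on a subset have the same differential on vectors tangent to the subset. -/
theorem mfderiv_eq_of_mem_subsetTangent {f₁ f₂ : M → M'} {S : Set M} {x : M}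
    (h₁ : MDifferentiableAt I I' f₁ x) (h₂ : MDifferentiableAt I I' f₂ x)
    (h : ∀ᶠ y in 𝓝[S] x, f₁ y = f₂ y) {v : TangentSpace I x} (hv : v ∈ subsetTangent I S x) :
    (mfderiv I I' f₁ x v : E') = (mfderiv I I' f₂ x v : E') := by
  obtain ⟨c, hc, hcv⟩ := hv
  have hc0 : c 0 = x := congrArg TotalSpace.proj hcv
  subst hc0
  have hcv' : mfderiv 𝓘(ℝ, ℝ) I c 0 (1 : ℝ) = v := by
    simpa [tangentMap] using hcv
  have hcd : MDifferentiableAt 𝓘(ℝ, ℝ) I c 0 :=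
    hc.self_of_nhds.1.mdifferentiableAt (by simp)
  -- The curve stays in S, so agreement on S near x becomes agreement of the two composites near
  -- time 0.
  have hev : f₁ ∘ c =ᶠ[𝓝 0] f₂ ∘ c :=
    (tendsto_nhdsWithin_iff.2 ⟨hcd.continuousAt, hc.mono fun _ h => h.2⟩).eventually h
  have key : (mfderiv 𝓘(ℝ, ℝ) I' (f₁ ∘ c) 0 : ℝ →L[ℝ] E') =
      (mfderiv 𝓘(ℝ, ℝ) I' (f₂ ∘ c) 0 : ℝ →L[ℝ] E') := by
    have := hev.mfderiv_eq (I := 𝓘(ℝ, ℝ)) (I' := I')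
    exact this
  rw [mfderiv_comp 0 h₁ hcd, mfderiv_comp 0 h₂ hcd] at key
  have := congrArg (fun L : ℝ →L[ℝ] E' => L 1) key
  rw [← hcv']
  exact this

theorem IsSmoothExtensionAt.contMDiffAt {f F : M → M'} {S : Set M} {x : M}
    (h : IsSmoothExtensionAt I I' f S x F) : ContMDiffAt I I' ∞ F x := by
  obtain ⟨U, hU, hx, hF, -⟩ := h
  exact (hF x hx).contMDiffAt (hU.mem_nhds hx)

theorem IsSmoothExtensionAt.eventuallyEq {f F : M → M'} {S : Set M} {x : M}
    (h : IsSmoothExtensionAt I I' f S x F) : F =ᶠ[𝓝[S] x] f := by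
  obtain ⟨U, hU, hx, -, he⟩ := h
  filter_upwards [self_mem_nhdsWithin, mem_nhdsWithin_of_mem_nhds (hU.mem_nhds hx)] with y h₁ h₂
  exact he ⟨h₁, h₂⟩

theorem IsSmoothExtensionAt.of_eventually {f F : M → M'} {S : Set M} {x : M}
    (hF : ∀ᶠ y in 𝓝 x, ContMDiffAt I I' ∞ F y) (h : ∀ᶠ y in 𝓝 x, y ∈ S → F y = f y) :
    IsSmoothExtensionAt I I' f S x F := by
  obtain ⟨U, hU, hUo, hx⟩ := eventually_nhds_iff.1 (hF.and h)
  exact ⟨U, hUo, hx, fun y hy => (hU y hy).1.contMDiffWithinAt, fun y hy => (hU y hy.2).2 hy.1⟩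

/-- The chain rule for the differential of a map on a subset. -/
theorem mfderiv_subsetDeriv {f : M → M'} {S : Set M} {x : M} (hx : x ∈ S)
    (hf : ∃ F, IsSmoothExtensionAt I I' f S x F) {k : M' → M''} {g : M → M''}
    (hk : MDifferentiableAt I' I'' k (f x)) (hg : MDifferentiableAt I I'' g x)
    (h : ∀ y ∈ S, k (f y) = g y) {v : TangentSpace I x} (hv : v ∈ subsetTangent I S x) :
    (mfderiv I' I'' k (f x) (subsetDeriv I I' f S x v) : E'') = (mfderiv I I'' g x v : E'') := by
  obtain ⟨F, hF⟩ := hf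
  have hFx : F x = f x := hF.eventuallyEq.self_of_nhdsWithin hx
  have hFd : MDifferentiableAt I I' F x := hF.contMDiffAt.mdifferentiableAt (by simp)
  have hk' : MDifferentiableAt I' I'' k (F x) := by rwa [hFx]
  have e₁ : (subsetDeriv I I' f S x v : E') = (mfderiv I I' F x v : E') := subsetDeriv_eq hF hv
  -- The points F x and f x are equal only propositionally, so the two differentials are compared as
  -- maps of the model spaces.
  have e₂ : (mfderiv I' I'' k (f x) : E' →L[ℝ] E'') = (mfderiv I' I'' k (F x) : E' →L[ℝ] E'') := by
    rw [hFx]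
  have e₃ : (mfderiv I I'' (k ∘ F) x v : E'') = (mfderiv I I'' g x v : E'') := by
    refine mfderiv_eq_of_mem_subsetTangent (hk'.comp x hFd) hg ?_ hv
    filter_upwards [self_mem_nhdsWithin, hF.eventuallyEq] with y hy hy'
    exact (congrArg k hy').trans (h y hy)
  rw [mfderiv_comp x hk' hFd] at e₃
  refine Eq.trans ?_ e₃
  exact congrArg₂ (fun (A : E' →L[ℝ] E'') (w : E') => A w) e₂ e₁

/-- A local extension F carries a curve in S with velocity v to a curve in T, since F agrees with f
along it. -/
theorem subsetDeriv_mem_subsetTangent {f : M → M'} {S : Set M} {T : Set M'} {x : M} (hx : x ∈ S)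
    (hf : ∃ F, IsSmoothExtensionAt I I' f S x F) (hST : MapsTo f S T)
    {v : TangentSpace I x} (hv : v ∈ subsetTangent I S x) :
    subsetDeriv I I' f S x v ∈ subsetTangent I' T (f x) := by
  obtain ⟨F, hF⟩ := hf
  have hFx : F x = f x := hF.eventuallyEq.self_of_nhdsWithin hx
  have hFd : MDifferentiableAt I I' F x := hF.contMDiffAt.mdifferentiableAt (by simp)
  have e₁ : (subsetDeriv I I' f S x v : E') = (mfderiv I I' F x v : E') := subsetDeriv_eq hF hv
  obtain ⟨U, hU, hxU, hFU, he⟩ := hF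
  obtain ⟨c, hc, hcv⟩ := hv
  have hc0 : c 0 = x := congrArg TotalSpace.proj hcv
  subst hc0
  have hcv' : mfderiv 𝓘(ℝ, ℝ) I c 0 (1 : ℝ) = v := by
    simpa [tangentMap] using hcv
  have hcd : MDifferentiableAt 𝓘(ℝ, ℝ) I c 0 :=
    hc.self_of_nhds.1.mdifferentiableAt (by simp)
  refine ⟨F ∘ c, ?_, ?_⟩
  · filter_upwards [hc, hcd.continuousAt.preimage_mem_nhds (hU.mem_nhds hxU)] with τ h₁ h₂
    refine ⟨((hFU _ h₂).contMDiffAt (hU.mem_nhds h₂)).comp τ h₁.1, ?_⟩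
    change F (c τ) ∈ T
    rw [he ⟨h₁.2, h₂⟩]
    exact hST h₁.2
  · have e₂ : (mfderiv 𝓘(ℝ, ℝ) I' (F ∘ c) 0 (1 : ℝ) : E') = subsetDeriv I I' f S (c 0) v := by
      rw [mfderiv_comp 0 hFd hcd, e₁, ← hcv']
      rfl
    change (⟨F (c 0), mfderiv 𝓘(ℝ, ℝ) I' (F ∘ c) 0 (1 : ℝ)⟩ : TangentBundle I' M') = _
    rw [TotalSpace.mk.injEq]
    exact ⟨hFx, heq_of_eq e₂⟩

end SubsetCalculus

/-! ### Normal form and splittings of a submersion. -/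

section Submersions

variable {E F Q X : Type*}
  [NormedAddCommGroup E] [NormedSpace ℝ E] [TopologicalSpace Q] [ChartedSpace E Q]
  [IsManifold 𝓘(ℝ, E) ∞ Q]
  [NormedAddCommGroup F] [NormedSpace ℝ F] [TopologicalSpace X] [ChartedSpace F X]
  [IsManifold 𝓘(ℝ, F) ∞ X]

/-- The normal form of a submersion: in suitable charts it is a split linear surjection. -/
theorem IsSubmersion.exists_charts {q : Q → X} (hq : IsSubmersion 𝓘(ℝ, E) 𝓘(ℝ, F) ∞ q) (x : Q) :
    ∃ (φ : OpenPartialHomeomorph Q E) (ψ : OpenPartialHomeomorph X F) (P : E →L[ℝ] F)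
      (R : F →L[ℝ] E), x ∈ φ.source ∧ MapsTo q φ.source ψ.source ∧
      φ ∈ IsManifold.maximalAtlas 𝓘(ℝ, E) ∞ Q ∧ ψ ∈ IsManifold.maximalAtlas 𝓘(ℝ, F) ∞ X ∧
      (∀ w, P (R w) = w) ∧ ∀ y ∈ φ.source, ψ (q y) = P (φ y) := by
  have h := hq.isSubmersionAt x
  refine ⟨h.domChart, h.codChart, (ContinuousLinearMap.fst ℝ F h.complement) ∘L h.equiv,
    h.equiv.symm ∘L (ContinuousLinearMap.inl ℝ F h.complement), h.mem_domChart_source,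
    h.source_subset_preimage_source, h.domChart_mem_maximalAtlas, h.codChart_mem_maximalAtlas,
    fun w => by simp, fun y hy => ?_⟩
  have hy' : h.domChart y ∈ (h.domChart.extend 𝓘(ℝ, E)).target := by
    simpa using h.domChart.map_source hy
  have := h.writtenInCharts hy'
  simpa [h.domChart.left_inv hy] using this

/-- The differential of a submersion has a right inverse. -/
theorem IsSubmersion.exists_rightInverse {q : Q → X} (hq : IsSubmersion 𝓘(ℝ, E) 𝓘(ℝ, F) ∞ q)
    (x : Q) : ∃ R : F →L[ℝ] E,
      (mfderiv 𝓘(ℝ, E) 𝓘(ℝ, F) q x : E →L[ℝ] F) ∘L R = ContinuousLinearMap.id ℝ F := by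
  obtain ⟨φ, ψ, P, R, hx, hm, hφ, hψ, hPR, h⟩ := IsSubmersion.exists_charts hq x
  -- A local section of q through x, affine in the adapted charts; its differential is the right
  -- inverse.
  set σ : X → Q := fun u => φ.symm (φ x + R (ψ u - ψ (q x))) with hσ
  have hσx : σ (q x) = x := by simp [hσ, φ.left_inv hx]
  have hψd : ContMDiffAt 𝓘(ℝ, F) 𝓘(ℝ, F) ∞ ψ (q x) :=
    contMDiffAt_of_mem_maximalAtlas hψ (hm hx)
  have hin : ContMDiffAt 𝓘(ℝ, F) 𝓘(ℝ, E) ∞ (fun u => φ x + R (ψ u - ψ (q x))) (q x) :=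
    ContMDiffAt.comp (g := fun z => φ x + R (z - ψ (q x))) (q x)
      (ContDiff.contMDiff (by fun_prop)).contMDiffAt hψd
  have hin0 : φ x + R (ψ (q x) - ψ (q x)) = φ x := by simp
  have hσd : ContMDiffAt 𝓘(ℝ, F) 𝓘(ℝ, E) ∞ σ (q x) := by
    refine ContMDiffAt.comp (g := φ.symm) (q x) ?_ hin
    exact contMDiffAt_symm_of_mem_maximalAtlas hφ (by rw [hin0]; exact φ.map_source hx)
  have hid : q ∘ σ =ᶠ[𝓝 (q x)] id := by
    filter_upwards [ψ.open_source.mem_nhds (hm hx), hin.continuousAt.preimage_mem_nhds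
      (φ.open_target.mem_nhds (by rw [hin0]; exact φ.map_source hx))] with u hu hu'
    have hs : σ u ∈ φ.source := φ.map_target hu'
    refine ψ.injOn (hm hs) hu ?_
    change ψ (q (σ u)) = ψ u
    rw [h _ hs, hσ, φ.right_inv hu', map_add, hPR, ← h x hx]
    abel
  refine ⟨mfderiv 𝓘(ℝ, F) 𝓘(ℝ, E) σ (q x), ?_⟩
  have hqd : MDifferentiableAt 𝓘(ℝ, E) 𝓘(ℝ, F) q (σ (q x)) :=
    (hq.contMDiff _).mdifferentiableAt (by simp)
  have e := hid.mfderiv_eq (I := 𝓘(ℝ, F)) (I' := 𝓘(ℝ, F))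
  rw [mfderiv_comp _ hqd (hσd.mdifferentiableAt (by simp)), mfderiv_id, hσx] at e
  exact e

theorem IsSubmersion.mfderiv_surjective {q : Q → X} (hq : IsSubmersion 𝓘(ℝ, E) 𝓘(ℝ, F) ∞ q)
    (x : Q) : Function.Surjective (mfderiv 𝓘(ℝ, E) 𝓘(ℝ, F) q x) := by
  obtain ⟨R, hR⟩ := IsSubmersion.exists_rightInverse hq x
  exact fun w => ⟨R w, DFunLike.congr_fun hR w⟩

end Submersions

/-! ### Algebra of jets; openness of invertibility. -/

namespace Jet

variable {E F M N : Type*}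
  [NormedAddCommGroup E] [NormedSpace ℝ E] [TopologicalSpace M] [ChartedSpace E M]
  [IsManifold 𝓘(ℝ, E) ∞ M]
  [NormedAddCommGroup F] [NormedSpace ℝ F] [TopologicalSpace N] [ChartedSpace F N]
  [IsManifold 𝓘(ℝ, F) ∞ N]

theorem ext_linear {j j' : Jet E F M N} (h₁ : j.s = j'.s) (h₂ : j.t = j'.t)
    (h₃ : j.linear = j'.linear) : j = j' := ext_lin h₁ h₂ h₃

theorem comp_linear {G R : Type*} [NormedAddCommGroup G] [NormedSpace ℝ G] [TopologicalSpace R]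
    [ChartedSpace G R] [IsManifold 𝓘(ℝ, G) ∞ R] (b : Jet F G N R) (a : Jet E F M N) :
    (b.comp a).linear = b.linear ∘L a.linear := rfl

theorem inv_linear (a : Jet E F M N) : a.inv.linear = a.linear.inverse := rfl

theorem ofMap_id_linear (x : M) :
    (ofMap id x : Jet E E M M).linear = ContinuousLinearMap.id ℝ E := by
  change (mfderiv 𝓘(ℝ, E) 𝓘(ℝ, E) id x : E →L[ℝ] E) = _
  rw [mfderiv_id]
  rfl

theorem ofMap_comp {G R : Type*} [NormedAddCommGroup G] [NormedSpace ℝ G] [TopologicalSpace R]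
    [ChartedSpace G R] [IsManifold 𝓘(ℝ, G) ∞ R] {f : M → N} {g : N → R} {x : M}
    (hg : MDifferentiableAt 𝓘(ℝ, F) 𝓘(ℝ, G) g (f x))
    (hf : MDifferentiableAt 𝓘(ℝ, E) 𝓘(ℝ, F) f x) :
    (ofMap (g ∘ f) x : Jet E G M R) = (ofMap g (f x) : Jet F G N R).comp (ofMap f x) :=
  ext_lin rfl rfl (mfderiv_comp x hg hf)

theorem ofMap_congr {f g : M → N} {x : M} (h : f =ᶠ[𝓝 x] g) :
    (ofMap f x : Jet E F M N) = ofMap g x :=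
  ext_lin rfl h.self_of_nhds h.mfderiv_eq

theorem contMDiff_ofMap {f : M → N} (hf : ContMDiff 𝓘(ℝ, E) 𝓘(ℝ, F) ∞ f) :
    ContMDiff 𝓘(ℝ, E) (jetModel E F) ∞ (fun x => (ofMap f x : Jet E F M N)) := fun x =>
  contMDiffAt_ofMap (f := fun _ : M => f) (g := id)
    (ContMDiffAt.comp (g := f) (f := Prod.snd) (x, x) (hf x) contMDiffAt_snd) contMDiffAt_id

theorem linear_eq {a : M} {b : N} {j : Jet E F M N}
    (hs : j.s ∈ (chartAt E a).source) (ht : j.t ∈ (chartAt F b).source) :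
    j.linear = ofFrame b j.t ∘L j.coord a b ∘L toFrame a j.s := by
  ext v
  change _ = ofFrame b j.t (toFrame b j.t (j.linear (ofFrame a j.s (toFrame a j.s v))))
  rw [ofFrame_toFrame ht, ofFrame_toFrame hs]

theorem coord_isInvertible_iff {a : M} {b : N} {j : Jet E F M N}
    (hs : j.s ∈ (chartAt E a).source) (ht : j.t ∈ (chartAt F b).source) :
    (j.coord a b).IsInvertible ↔ j.linear.IsInvertible := by
  refine ⟨fun h => ?_, fun h => (isInvertible_toFrame ht).comp (h.comp (isInvertible_ofFrame hs))⟩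
  rw [linear_eq hs ht]
  exact (isInvertible_ofFrame ht).comp (h.comp (isInvertible_toFrame hs))

theorem ofFrames_linear (a : M) (b : N) (A : E →L[ℝ] F) (p : M × N) :
    (ofFrames a b A p).linear = ofFrame b p.2 ∘L A ∘L toFrame a p.1 := rfl

variable {E' H' M' : Type*} [NormedAddCommGroup E'] [NormedSpace ℝ E'] [TopologicalSpace H']
  {I' : ModelWithCorners ℝ E' H'} [TopologicalSpace M'] [ChartedSpace H' M']

theorem eventually_isInvertible [CompleteSpace E] {f : M' → Jet E F M N} {x : M'}
    (hf : ContMDiffAt I' (jetModel E F) ∞ f x) (h : (f x).linear.IsInvertible) :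
    ∀ᶠ y in 𝓝 x, (f y).linear.IsInvertible := by
  have hs := mem_chart_source E (f x).s
  have ht := mem_chart_source F (f x).t
  have hf' := (contMDiffAt_iff hs ht).1 hf
  obtain ⟨e, he⟩ := (coord_isInvertible_iff hs ht).2 h
  filter_upwards [hf'.1.continuousAt.preimage_mem_nhds ((chartAt E _).open_source.mem_nhds hs),
    hf'.2.1.continuousAt.preimage_mem_nhds ((chartAt F _).open_source.mem_nhds ht),
    hf'.2.2.continuousAt.preimage_mem_nhds (he ▸ e.nhds)] with y hy₁ hy₂ hy₃
  exact (coord_isInvertible_iff hy₁ hy₂).1 hy₃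

end Jet

/-! ### Smooth splittings and the groupoid of point symmetries. -/

section PointSymmetryJets

variable {E F Q X : Type*}
  [NormedAddCommGroup E] [NormedSpace ℝ E] [TopologicalSpace Q] [ChartedSpace E Q]
  [IsManifold 𝓘(ℝ, E) ∞ Q]
  [NormedAddCommGroup F] [NormedSpace ℝ F] [TopologicalSpace X] [ChartedSpace F X]
  [IsManifold 𝓘(ℝ, F) ∞ X]

/-- Near any point, a submersion has a smooth family of splittings of its differential. -/
theorem IsSubmersion.exists_splitting [CompleteSpace F] {q : Q → X}
    (hq : IsSubmersion 𝓘(ℝ, E) 𝓘(ℝ, F) ∞ q) (x₀ : Q) :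
    ∃ σ : Q → Jet F E X Q, ∀ᶠ x in 𝓝 x₀, ContMDiffAt 𝓘(ℝ, E) (jetModel F E) ∞ σ x ∧
      (σ x).s = q x ∧ (σ x).t = x ∧
      (Jet.ofMap q x : Jet E F Q X).linear ∘L (σ x).linear = ContinuousLinearMap.id ℝ F := by
  obtain ⟨R, hR⟩ := IsSubmersion.exists_rightInverse hq x₀
  -- The right inverse at x₀ is extended as a constant in frames. Away from x₀ it need not split Tq,
  -- but κ = Tq ∘ ρ stays invertible nearby, and ρ ∘ κ⁻¹ is a splitting.
  set ρ : Q → Jet F E X Q := fun x => Jet.ofFrames (q x₀) x₀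
    (toFrame x₀ x₀ ∘L R ∘L ofFrame (q x₀) (q x₀)) (q x, x) with hρ
  set κ : Q → Jet F F X X := fun x => (Jet.ofMap q x : Jet E F Q X).comp (ρ x) with hκ
  have hqc := hq.contMDiff
  have hρ₀ : (ρ x₀).linear = R := by
    ext v
    change ofFrame x₀ x₀ (toFrame x₀ x₀ (R (ofFrame (q x₀) (q x₀) (toFrame (q x₀) (q x₀) v)))) = _
    rw [ofFrame_toFrame (mem_chart_source E _), ofFrame_toFrame (mem_chart_source F _)]
  have hρd : ∀ᶠ x in 𝓝 x₀, ContMDiffAt 𝓘(ℝ, E) (jetModel F E) ∞ ρ x := by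
    filter_upwards [(chartAt E x₀).open_source.mem_nhds (mem_chart_source E _),
      hqc.continuous.continuousAt.preimage_mem_nhds
        ((chartAt F (q x₀)).open_source.mem_nhds (mem_chart_source F _))] with x h₁ h₂
    exact Jet.contMDiffAt_ofFrames _ _ _ (hqc x) contMDiffAt_id h₂ h₁
  have hκd : ∀ᶠ x in 𝓝 x₀, ContMDiffAt 𝓘(ℝ, E) (jetModel F F) ∞ κ x :=
    hρd.mono fun x hx => Jet.contMDiffAt_comp (Jet.contMDiff_ofMap hqc x) hx
      (Eventually.of_forall fun _ => rfl)
  have hκ₀ : (κ x₀).linear.IsInvertible := by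
    have : (κ x₀).linear = ContinuousLinearMap.id ℝ F := by
      rw [hκ, Jet.comp_linear, hρ₀]
      exact hR
    rw [this]
    exact ⟨.refl ℝ F, rfl⟩
  refine ⟨fun x => (ρ x).comp (κ x).inv, ?_⟩
  filter_upwards [hρd, hκd, Jet.eventually_isInvertible hκd.self_of_nhds hκ₀] with x h₁ h₂ h₃
  refine ⟨Jet.contMDiffAt_comp h₁ (Jet.contMDiffAt_inv h₂ h₃) (Eventually.of_forall fun _ => rfl),
    rfl, rfl, ?_⟩
  rw [Jet.comp_linear, ← ContinuousLinearMap.comp_assoc, ← Jet.comp_linear, Jet.inv_linear]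
  exact h₃.self_comp_inverse

theorem IsLocalDiffeo.mdifferentiableAt {φ : OpenPartialHomeomorph Q Q} (h : IsLocalDiffeo E φ)
    {x : Q} (hx : x ∈ φ.source) : MDifferentiableAt 𝓘(ℝ, E) 𝓘(ℝ, E) φ x :=
  ((h.1 x hx).contMDiffAt (φ.open_source.mem_nhds hx)).mdifferentiableAt (by simp)

theorem IsLocalDiffeo.symm {φ : OpenPartialHomeomorph Q Q} (h : IsLocalDiffeo E φ) :
    IsLocalDiffeo E φ.symm := ⟨h.2, h.1⟩

theorem IsLocalDiffeo.trans {φ φ' : OpenPartialHomeomorph Q Q} (h : IsLocalDiffeo E φ)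
    (h' : IsLocalDiffeo E φ') : IsLocalDiffeo E (φ.trans φ') := by
  refine ⟨?_, ?_⟩
  · rw [OpenPartialHomeomorph.coe_trans, OpenPartialHomeomorph.trans_source]
    exact h'.1.comp (h.1.mono inter_subset_left) fun x hx => hx.2
  · rw [OpenPartialHomeomorph.coe_trans_symm, OpenPartialHomeomorph.trans_target]
    exact h.2.comp (h'.2.mono inter_subset_left) fun x hx => hx.2

theorem IsLocalDiffeo.refl : IsLocalDiffeo E (OpenPartialHomeomorph.refl Q) :=
  ⟨contMDiffOn_id, contMDiffOn_id⟩

/-- Differentiate both composites of φ and its inverse, which are the identity near x and near φ x.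
-/
theorem IsLocalDiffeo.inverse_ofMap {φ : OpenPartialHomeomorph Q Q} (h : IsLocalDiffeo E φ)
    {x : Q} (hx : x ∈ φ.source) :
    (Jet.ofMap φ x : Jet E E Q Q).linear.IsInvertible ∧
      (Jet.ofMap φ x : Jet E E Q Q).inv = Jet.ofMap φ.symm (φ x) := by
  have hx' := φ.map_source hx
  have e₁ : (Jet.ofMap (φ.symm ∘ φ) x : Jet E E Q Q) = Jet.ofMap id x := by
    refine Jet.ofMap_congr ?_
    filter_upwards [φ.open_source.mem_nhds hx] with y hy using φ.left_inv hy
  have e₂ : (Jet.ofMap (φ ∘ φ.symm) (φ x) : Jet E E Q Q) = Jet.ofMap id (φ x) := by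
    refine Jet.ofMap_congr ?_
    filter_upwards [φ.open_target.mem_nhds hx'] with y hy using φ.right_inv hy
  rw [Jet.ofMap_comp (h.symm.mdifferentiableAt hx') (h.mdifferentiableAt hx)] at e₁
  rw [Jet.ofMap_comp (by rw [φ.left_inv hx]; exact h.mdifferentiableAt hx)
    (h.symm.mdifferentiableAt hx'), φ.left_inv hx] at e₂
  have f₁ := (congrArg Jet.linear e₁).trans (Jet.ofMap_id_linear x)
  have f₂ := (congrArg Jet.linear e₂).trans (Jet.ofMap_id_linear (φ x))
  rw [Jet.comp_linear] at f₁ f₂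
  refine ⟨.of_inverse f₂ f₁, Jet.ext_linear rfl (φ.left_inv hx).symm ?_⟩
  exact ContinuousLinearMap.inverse_eq f₂ f₁

theorem IsLift.refl (q : Q → X) :
    IsLift E F q (OpenPartialHomeomorph.refl Q) (OpenPartialHomeomorph.refl X) :=
  ⟨.refl, .refl, fun _ _ => mem_univ _, fun _ _ => rfl⟩

theorem IsLift.symm {q : Q → X} {φ : OpenPartialHomeomorph Q Q} {ψ : OpenPartialHomeomorph X X}
    (h : IsLift E F q φ ψ) : IsLift E F q φ.symm ψ.symm := by
  have key : ∀ y ∈ φ.target, q y = ψ (q (φ.symm y)) := fun y hy => by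
    rw [← h.comm _ (φ.map_target hy), φ.right_inv hy]
  refine ⟨h.diffeo_top.symm, h.diffeo_base.symm, fun y hy => ?_, fun y hy => ?_⟩
  · change q y ∈ ψ.target
    rw [key y hy]
    exact ψ.map_source (h.mapsTo (φ.map_target hy))
  · rw [key y hy, ψ.left_inv (h.mapsTo (φ.map_target hy))]

theorem IsLift.trans {q : Q → X} {φ φ' : OpenPartialHomeomorph Q Q}
    {ψ ψ' : OpenPartialHomeomorph X X} (h : IsLift E F q φ ψ) (h' : IsLift E F q φ' ψ') :
    IsLift E F q (φ.trans φ') (ψ.trans ψ') := by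
  refine ⟨h.diffeo_top.trans h'.diffeo_top, h.diffeo_base.trans h'.diffeo_base, ?_, ?_⟩
  · intro x hx
    rw [OpenPartialHomeomorph.trans_source] at hx ⊢
    refine ⟨h.mapsTo hx.1, ?_⟩
    change ψ (q x) ∈ ψ'.source
    rw [← h.comm x hx.1]
    exact h'.mapsTo hx.2
  · intro x hx
    rw [OpenPartialHomeomorph.trans_source] at hx
    change q (φ' (φ x)) = ψ' (ψ (q x))
    rw [h'.comm _ hx.2, h.comm x hx.1]

variable {q : Q → X}

theorem baseJet_eq_ofMap (hq : IsSubmersion 𝓘(ℝ, E) 𝓘(ℝ, F) ∞ q)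
    {φ : OpenPartialHomeomorph Q Q} {ψ : OpenPartialHomeomorph X X}
    (hl : IsLift E F q φ ψ) {x : Q} (hx : x ∈ φ.source) :
    baseJet E F q (Jet.ofMap φ x : Jet E E Q Q) = Jet.ofMap ψ (q x) :=
  baseJet_ofMap hq.contMDiff (IsSubmersion.mfderiv_surjective hq) hl hx

/-- No membership of g is required, since the default value of `baseJet` is also a jet at `q g.s`.
-/
theorem baseJet_s {g : Jet E E Q Q} : (baseJet E F q g).s = q g.s := by
  unfold baseJet
  split_ifs <;> rfl

/-- The base jet of `g` is the jet intertwined with `g` by the differential of `q`. -/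
theorem baseJet_comp (hq : IsSubmersion 𝓘(ℝ, E) 𝓘(ℝ, F) ∞ q) {g : Jet E E Q Q}
    (hg : g ∈ pointJets E F q) :
    (baseJet E F q g).comp (Jet.ofMap q g.s : Jet E F Q X) =
      (Jet.ofMap q g.t : Jet E F Q X).comp g := by
  obtain ⟨φ, ψ, x, hl, hx, rfl⟩ := hg
  have hqd : ∀ y, MDifferentiableAt 𝓘(ℝ, E) 𝓘(ℝ, F) q y := fun y =>
    (hq.contMDiff y).mdifferentiableAt (by simp)
  rw [baseJet_eq_ofMap hq hl hx]
  change (Jet.ofMap ψ (q x) : Jet F F X X).comp (Jet.ofMap q x : Jet E F Q X) =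
    (Jet.ofMap q (φ x) : Jet E F Q X).comp (Jet.ofMap φ x : Jet E E Q Q)
  -- By the chain rule the two sides are the jets at x of ψ ∘ q and q ∘ φ, which agree on the source
  -- of φ.
  rw [← Jet.ofMap_comp (hqd _) (hl.diffeo_top.mdifferentiableAt hx),
    ← Jet.ofMap_comp (hl.diffeo_base.mdifferentiableAt (hl.mapsTo hx)) (hqd _)]
  refine Jet.ofMap_congr ?_
  filter_upwards [φ.open_source.mem_nhds hx] with y hy using (hl.comm y hy).symm

theorem baseJet_t (hq : IsSubmersion 𝓘(ℝ, E) 𝓘(ℝ, F) ∞ q) {g : Jet E E Q Q}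
    (hg : g ∈ pointJets E F q) : (baseJet E F q g).t = q g.t :=
  congrArg Jet.t (baseJet_comp hq hg)

theorem baseJet_isInvertible (hq : IsSubmersion 𝓘(ℝ, E) 𝓘(ℝ, F) ∞ q) {g : Jet E E Q Q}
    (hg : g ∈ pointJets E F q) : (baseJet E F q g).linear.IsInvertible := by
  obtain ⟨φ, ψ, x, hl, hx, rfl⟩ := hg
  rw [baseJet_eq_ofMap hq hl hx]
  exact (hl.diffeo_base.inverse_ofMap (hl.mapsTo hx)).1

theorem ofMap_id_mem_pointJets (x : Q) : (Jet.ofMap id x : Jet E E Q Q) ∈ pointJets E F q :=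
  ⟨_, _, x, IsLift.refl q, mem_univ x, rfl⟩

theorem inv_mem_pointJets {g : Jet E E Q Q} (hg : g ∈ pointJets E F q) :
    g.inv ∈ pointJets E F q := by
  obtain ⟨φ, ψ, x, hl, hx, rfl⟩ := hg
  exact ⟨_, _, φ x, hl.symm, φ.map_source hx, (hl.diffeo_top.inverse_ofMap hx).2⟩

/-- Lifts compose, over the composite of the base maps; independence of representatives then makes
q̄ multiplicative. -/
theorem comp_mem_pointJets (hq : IsSubmersion 𝓘(ℝ, E) 𝓘(ℝ, F) ∞ q) {g₁ g₂ : Jet E E Q Q}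
    (hg₁ : g₁ ∈ pointJets E F q) (hg₂ : g₂ ∈ pointJets E F q) (h : g₁.s = g₂.t) :
    g₁.comp g₂ ∈ pointJets E F q ∧
      baseJet E F q (g₁.comp g₂) = (baseJet E F q g₁).comp (baseJet E F q g₂) := by
  obtain ⟨φ₁, ψ₁, x₁, hl₁, hx₁, rfl⟩ := hg₁
  obtain ⟨φ₂, ψ₂, x, hl₂, hx, rfl⟩ := hg₂
  obtain rfl : x₁ = φ₂ x := h
  have hxs : x ∈ (φ₂.trans φ₁).source := by
    rw [OpenPartialHomeomorph.trans_source]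
    exact ⟨hx, hx₁⟩
  have e : (Jet.ofMap φ₁ (φ₂ x) : Jet E E Q Q).comp (Jet.ofMap φ₂ x : Jet E E Q Q) =
      Jet.ofMap (φ₂.trans φ₁) x :=
    (Jet.ofMap_comp (hl₁.diffeo_top.mdifferentiableAt hx₁)
      (hl₂.diffeo_top.mdifferentiableAt hx)).symm
  refine ⟨⟨_, _, x, hl₂.trans hl₁, hxs, e⟩, ?_⟩
  have hψ₁ := hl₁.mapsTo hx₁
  rw [e, baseJet_eq_ofMap hq (hl₂.trans hl₁) hxs, baseJet_eq_ofMap hq hl₁ hx₁,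
    baseJet_eq_ofMap hq hl₂ hx, hl₂.comm x hx]
  rw [hl₂.comm x hx] at hψ₁
  exact Jet.ofMap_comp (hl₁.diffeo_base.mdifferentiableAt hψ₁)
    (hl₂.diffeo_base.mdifferentiableAt (hl₂.mapsTo hx))

theorem baseJet_ofMap_id (hq : IsSubmersion 𝓘(ℝ, E) 𝓘(ℝ, F) ∞ q) (x : Q) :
    baseJet E F q (Jet.ofMap id x : Jet E E Q Q) = Jet.ofMap id (q x) :=
  baseJet_eq_ofMap hq (IsLift.refl q) (mem_univ x)

theorem mem_sectionJets_iff {h : Jet F E X Q} : h ∈ sectionJets E F q ↔ h.s = q h.t ∧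
    (Jet.ofMap q h.t : Jet E F Q X).linear ∘L h.linear = ContinuousLinearMap.id ℝ F := by
  constructor
  · rintro ⟨x, L, hL, rfl⟩
    exact ⟨rfl, hL⟩
  · rintro ⟨hs, hL⟩
    exact ⟨h.t, h.linear, hL, Jet.ext_lin hs rfl rfl⟩

end PointSymmetryJets

/-! ### Smoothness of q̄ and of the action; the action axioms. -/

section SmoothAction

variable {E F Q X : Type*}
  [NormedAddCommGroup E] [NormedSpace ℝ E] [TopologicalSpace Q] [ChartedSpace E Q]
  [IsManifold 𝓘(ℝ, E) ∞ Q]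
  [NormedAddCommGroup F] [NormedSpace ℝ F] [TopologicalSpace X] [ChartedSpace F X]
  [IsManifold 𝓘(ℝ, F) ∞ X] {q : Q → X}

/-- Composing ḡ ∘ Tq = Tq ∘ g with a splitting σ of Tq isolates ḡ = Tq ∘ g ∘ σ. The right side makes
sense for every jet g with source near the given one and is smooth there. -/
theorem isSmoothOnSubset_baseJet [CompleteSpace F] (hq : IsSubmersion 𝓘(ℝ, E) 𝓘(ℝ, F) ∞ q) :
    IsSmoothOnSubset (jetModel E E) (jetModel F F) (baseJet E F q) (pointJets E F q) := by
  intro g₀ hg₀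
  obtain ⟨σ, hσ⟩ := IsSubmersion.exists_splitting hq g₀.s
  have hσ' : ∀ᶠ g : Jet E E Q Q in 𝓝 g₀, ContMDiffAt 𝓘(ℝ, E) (jetModel F E) ∞ σ g.s ∧
      (σ g.s).s = q g.s ∧ (σ g.s).t = g.s ∧
      (Jet.ofMap q g.s : Jet E F Q X).linear ∘L (σ g.s).linear = ContinuousLinearMap.id ℝ F :=
    Jet.contMDiff_s.continuous.continuousAt.eventually hσ
  refine ⟨fun g => ((Jet.ofMap q g.t : Jet E F Q X).comp g).comp (σ g.s),
    IsSmoothExtensionAt.of_eventually ?_ ?_⟩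
  · filter_upwards [hσ', hσ'.eventually_nhds] with g hg hg'
    refine Jet.contMDiffAt_comp (Jet.contMDiffAt_comp
      (ContMDiffAt.comp g (Jet.contMDiff_ofMap hq.contMDiff _) (Jet.contMDiff_t g))
      contMDiffAt_id (Eventually.of_forall fun _ => rfl))
      (ContMDiffAt.comp g hg.1 (Jet.contMDiff_s g)) ?_
    filter_upwards [hg'] with k hk using hk.2.2.1.symm
  · filter_upwards [hσ'] with g hg hgS
    rw [← baseJet_comp hq hgS]
    refine Jet.ext_linear (hg.2.1.trans baseJet_s.symm) rfl ?_
    rw [Jet.comp_linear, Jet.comp_linear, ContinuousLinearMap.comp_assoc, hg.2.2.2]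
    rfl

theorem jetAction_s (a : Jet E E Q Q × Jet F E X Q) :
    (jetAction q a).s = (baseJet E F q a.1).t := rfl

theorem jetAction_t (a : Jet E E Q Q × Jet F E X Q) : (jetAction q a).t = a.1.t := rfl

theorem jetAction_linear (a : Jet E E Q Q × Jet F E X Q) : (jetAction q a).linear =
    (a.1.linear ∘L a.2.linear) ∘L (baseJet E F q a.1).linear.inverse := rfl

theorem jetAction_linear_comp (hq : IsSubmersion 𝓘(ℝ, E) 𝓘(ℝ, F) ∞ q)
    {a : Jet E E Q Q × Jet F E X Q} (ha : a ∈ actionSpace E F q) :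
    (jetAction q a).linear ∘L (baseJet E F q a.1).linear = a.1.linear ∘L a.2.linear := by
  rw [jetAction_linear, ContinuousLinearMap.comp_assoc,
    (baseJet_isInvertible hq ha.1).inverse_comp_self]
  rfl

/-- Tq ∘ g ∘ h ∘ ḡ⁻¹ = ḡ ∘ Tq ∘ h ∘ ḡ⁻¹ = ḡ ∘ ḡ⁻¹ = id. -/
theorem jetAction_mem_sectionJets (hq : IsSubmersion 𝓘(ℝ, E) 𝓘(ℝ, F) ∞ q)
    {a : Jet E E Q Q × Jet F E X Q} (ha : a ∈ actionSpace E F q) :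
    jetAction q a ∈ sectionJets E F q := by
  refine mem_sectionJets_iff.2 ⟨baseJet_t hq ha.1, ?_⟩
  have h₁ := congrArg Jet.linear (baseJet_comp hq ha.1)
  have h₂ := (mem_sectionJets_iff.1 ha.2.1).2
  rw [Jet.comp_linear, Jet.comp_linear] at h₁
  rw [jetAction_t, jetAction_linear, ← ContinuousLinearMap.comp_assoc,
    ← ContinuousLinearMap.comp_assoc, ← h₁, ContinuousLinearMap.comp_assoc, ha.2.2,
    ContinuousLinearMap.comp_assoc, ← ContinuousLinearMap.comp_assoc _ a.2.linear, h₂]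
  exact (baseJet_isInvertible hq ha.1).self_comp_inverse

theorem isSmoothOnSubset_jetAction [CompleteSpace F] (hq : IsSubmersion 𝓘(ℝ, E) 𝓘(ℝ, F) ∞ q) :
    IsSmoothOnSubset (actionModel E F) (jetModel F E) (jetAction q) (actionSpace E F q) := by
  intro a₀ ha₀
  obtain ⟨B, hB⟩ := isSmoothOnSubset_baseJet hq a₀.1 ha₀.1
  have hBx : B a₀.1 = baseJet E F q a₀.1 := hB.eventuallyEq.self_of_nhdsWithin ha₀.1
  have hB₀ : (B a₀.1).linear.IsInvertible := hBx ▸ baseJet_isInvertible hq ha₀.1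
  have hBi := Jet.eventually_isInvertible hB.contMDiffAt hB₀
  obtain ⟨U, hU, hxU, hBU, hBe⟩ := hB
  have hfst : Tendsto (Prod.fst : Jet E E Q Q × Jet F E X Q → _) (𝓝 a₀) (𝓝 a₀.1) :=
    continuous_fst.continuousAt
  have hBd : ∀ᶠ a : Jet E E Q Q × Jet F E X Q in 𝓝 a₀,
      ContMDiffAt (jetModel E E) (jetModel F F) ∞ B a.1 := by
    filter_upwards [hfst.eventually (hU.mem_nhds hxU)] with a ha
    exact (hBU _ ha).contMDiffAt (hU.mem_nhds ha)
  have hBd' : ∀ᶠ a : Jet E E Q Q × Jet F E X Q in 𝓝 a₀,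
      ContMDiffAt (actionModel E F) (jetModel F F) ∞ (fun a => B a.1) a :=
    hBd.mono fun a ha => ContMDiffAt.comp a ha contMDiffAt_fst
  have s₁ : ContMDiff (actionModel E F) 𝓘(ℝ, E) ∞
      (fun a : Jet E E Q Q × Jet F E X Q => a.1.s) := Jet.contMDiff_s.comp contMDiff_fst
  have t₂ : ContMDiff (actionModel E F) 𝓘(ℝ, E) ∞
      (fun a : Jet E E Q Q × Jet F E X Q => a.2.t) := Jet.contMDiff_t.comp contMDiff_snd
  have s₂ : ContMDiff (actionModel E F) 𝓘(ℝ, F) ∞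
      (fun a : Jet E E Q Q × Jet F E X Q => a.2.s) := Jet.contMDiff_s.comp contMDiff_snd
  have sB : ∀ᶠ a : Jet E E Q Q × Jet F E X Q in 𝓝 a₀,
      ContMDiffAt (actionModel E F) 𝓘(ℝ, F) ∞ (fun a => (B a.1).s) a :=
    hBd'.mono fun a ha =>
      ContMDiffAt.comp (g := Jet.s) (f := fun a => B a.1) a (Jet.contMDiff_s _) ha
  have hs₀ : (B a₀.1).s = a₀.2.s := by
    rw [hBx, baseJet_s, (mem_sectionJets_iff.1 ha₀.2.1).1, ha₀.2.2]
  have c₁ := s₁.continuous.continuousAt.preimage_mem_nhds (x := a₀)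
    ((chartAt E a₀.1.s).open_source.mem_nhds (mem_chart_source E _))
  have c₂ := t₂.continuous.continuousAt.preimage_mem_nhds (x := a₀)
    ((chartAt E a₀.1.s).open_source.mem_nhds (by rw [ha₀.2.2]; exact mem_chart_source E _))
  have c₃ := s₂.continuous.continuousAt.preimage_mem_nhds (x := a₀)
    ((chartAt F a₀.2.s).open_source.mem_nhds (mem_chart_source F _))
  have c₄ := sB.self_of_nhds.continuousAt.preimage_mem_nhds (x := a₀)
    ((chartAt F a₀.2.s).open_source.mem_nhds (by rw [hs₀]; exact mem_chart_source F _))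
  -- Off the action space p₁(h) and s(g) may differ, as may π(h) and the source of B(g), and
  -- composition of jets is then not known to be smooth. The two inserted jets are the identity in a
  -- frame and connect these points; on the action space they are unit jets, so the formula reduces
  -- to `jetAction`.
  refine ⟨fun a => (a.1.comp ((Jet.ofFrames a₀.1.s a₀.1.s (.id ℝ E) (a.2.t, a.1.s)).comp a.2)).comp
    ((Jet.ofFrames a₀.2.s a₀.2.s (.id ℝ F) ((B a.1).s, a.2.s)).comp (B a.1).inv),
    IsSmoothExtensionAt.of_eventually ?_ ?_⟩
  · filter_upwards [hBd', sB, c₁, c₂, c₃, c₄, hfst.eventually hBi] with a h₁ h₂ h₃ h₄ h₅ h₆ h₇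
    exact Jet.contMDiffAt_comp
      (Jet.contMDiffAt_comp contMDiffAt_fst
        (Jet.contMDiffAt_comp (Jet.contMDiffAt_ofFrames _ _ _ (t₂ a) (s₁ a) h₄ h₃) contMDiffAt_snd
          (Eventually.of_forall fun _ => rfl))
        (Eventually.of_forall fun _ => rfl))
      (Jet.contMDiffAt_comp (Jet.contMDiffAt_ofFrames _ _ _ h₂ (s₂ a) h₆ h₅)
        (Jet.contMDiffAt_inv h₁ h₇) (Eventually.of_forall fun _ => rfl))
      (Eventually.of_forall fun _ => rfl)
  · filter_upwards [hfst.eventually (hU.mem_nhds hxU), c₁, c₃] with a haU h₁ h₂ haS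
    have hBa : B a.1 = baseJet E F q a.1 := hBe ⟨haS.1, haU⟩
    have hs : (baseJet E F q a.1).s = a.2.s := by
      rw [baseJet_s, (mem_sectionJets_iff.1 haS.2.1).1, haS.2.2]
    rw [hBa, hs, ← haS.2.2]
    refine Jet.ext_linear rfl rfl ?_
    rw [jetAction_linear]
    simp only [Jet.comp_linear, Jet.ofFrames_linear, ContinuousLinearMap.id_comp, Jet.inv_linear]
    rw [ofFrame_comp_toFrame h₁, ofFrame_comp_toFrame h₂]
    rfl

theorem isSmoothGroupoidAction_jetAction [CompleteSpace F]
    (hq : IsSubmersion 𝓘(ℝ, E) 𝓘(ℝ, F) ∞ q) :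
    IsSmoothGroupoidAction q (jetAction q : Jet E E Q Q × Jet F E X Q → Jet F E X Q) where
  smooth := isSmoothOnSubset_jetAction hq
  mapsTo _ ha := jetAction_mem_sectionJets hq ha
  moment _ _ := rfl
  unit_mem := ofMap_id_mem_pointJets
  inv_mem _ := inv_mem_pointJets
  mul_mem _ h₁ _ h₂ h := (comp_mem_pointJets hq h₁ h₂ h).1
  unit_act h hh := by
    refine Jet.ext_linear ?_ rfl ?_
    · rw [jetAction_s]
      change (baseJet E F q (Jet.ofMap id h.t)).t = h.s
      rw [baseJet_ofMap_id hq, (mem_sectionJets_iff.1 hh).1]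
      rfl
    · rw [jetAction_linear]
      change ((Jet.ofMap id h.t : Jet E E Q Q).linear ∘L h.linear) ∘L
        (baseJet E F q (Jet.ofMap id h.t)).linear.inverse = h.linear
      rw [baseJet_ofMap_id hq, Jet.ofMap_id_linear, Jet.ofMap_id_linear,
        ContinuousLinearMap.inverse_id]
      rfl
  mul_act g₁ h₁ a ha h := by
    have hb := (comp_mem_pointJets hq h₁ ha.1 h).2
    refine Jet.ext_linear ?_ rfl ?_
    · rw [jetAction_s, jetAction_s]
      change (baseJet E F q (g₁.comp a.1)).t = (baseJet E F q g₁).t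
      rw [hb]
      rfl
    · rw [jetAction_linear, jetAction_linear, jetAction_linear]
      dsimp only
      rw [hb, Jet.comp_linear, Jet.comp_linear,
        (baseJet_isInvertible hq h₁).inverse_comp_of_left]
      rfl

end SmoothAction

/-! ### The Cartan forms in terms of Ts and Tt; the identity and the symmetry property. -/

section CartanForms

variable {E F Q X : Type*}
  [NormedAddCommGroup E] [NormedSpace ℝ E] [TopologicalSpace Q] [ChartedSpace E Q]
  [IsManifold 𝓘(ℝ, E) ∞ Q]
  [NormedAddCommGroup F] [NormedSpace ℝ F] [TopologicalSpace X] [ChartedSpace F X]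
  [IsManifold 𝓘(ℝ, F) ∞ X] {q : Q → X}

/-- The differential of the source map of `J¹Diff_loc(q)` at `(g, h)`. -/
def sourceDeriv (a : Jet E E Q Q × Jet F E X Q) (v : TangentSpace (actionModel E F) a) : E :=
  mfderiv (jetModel E E) 𝓘(ℝ, E) Jet.s a.1 (prG a v)

/-- The differential of the target map of `J¹Diff_loc(q)` at `(g, h)`. -/
def targetDeriv (a : Jet E E Q Q × Jet F E X Q) (v : TangentSpace (actionModel E F) a) : E :=
  mfderiv (jetModel E E) 𝓘(ℝ, E) Jet.t a.1 (prG a v)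

theorem mdifferentiable_jet_s {E F M N : Type*}
    [NormedAddCommGroup E] [NormedSpace ℝ E] [TopologicalSpace M] [ChartedSpace E M]
    [IsManifold 𝓘(ℝ, E) ∞ M]
    [NormedAddCommGroup F] [NormedSpace ℝ F] [TopologicalSpace N] [ChartedSpace F N]
    [IsManifold 𝓘(ℝ, F) ∞ N] :
    MDifferentiable (jetModel E F) 𝓘(ℝ, E) (Jet.s : Jet E F M N → M) :=
  Jet.contMDiff_s.mdifferentiable (by simp)

theorem mdifferentiable_jet_t {E F M N : Type*}
    [NormedAddCommGroup E] [NormedSpace ℝ E] [TopologicalSpace M] [ChartedSpace E M]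
    [IsManifold 𝓘(ℝ, E) ∞ M]
    [NormedAddCommGroup F] [NormedSpace ℝ F] [TopologicalSpace N] [ChartedSpace F N]
    [IsManifold 𝓘(ℝ, F) ∞ N] :
    MDifferentiable (jetModel E F) 𝓘(ℝ, F) (Jet.t : Jet E F M N → N) :=
  Jet.contMDiff_t.mdifferentiable (by simp)

theorem mfderiv_source (a : Jet E E Q Q × Jet F E X Q) (v : TangentSpace (actionModel E F) a) :
    (mfderiv (actionModel E F) 𝓘(ℝ, E) (Jet.s ∘ Prod.fst) a v : E) = sourceDeriv a v := by
  rw [mfderiv_comp a (mdifferentiable_jet_s _) mdifferentiableAt_fst]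
  rfl

theorem mfderiv_target (a : Jet E E Q Q × Jet F E X Q) (v : TangentSpace (actionModel E F) a) :
    (mfderiv (actionModel E F) 𝓘(ℝ, E) (Jet.t ∘ Prod.fst) a v : E) = targetDeriv a v := by
  rw [mfderiv_comp a (mdifferentiable_jet_t _) mdifferentiableAt_fst]
  rfl

theorem mdifferentiableAt_q_source (hq : IsSubmersion 𝓘(ℝ, E) 𝓘(ℝ, F) ∞ q) (g : Jet E E Q Q) :
    MDifferentiableAt (jetModel E E) 𝓘(ℝ, F) (q ∘ Jet.s) g :=
  ((hq.contMDiff.comp Jet.contMDiff_s) g).mdifferentiableAt (by simp)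

theorem mdifferentiableAt_q_target (hq : IsSubmersion 𝓘(ℝ, E) 𝓘(ℝ, F) ∞ q) (g : Jet E E Q Q) :
    MDifferentiableAt (jetModel E E) 𝓘(ℝ, F) (q ∘ Jet.t) g :=
  ((hq.contMDiff.comp Jet.contMDiff_t) g).mdifferentiableAt (by simp)

theorem mfderiv_q_source (hq : IsSubmersion 𝓘(ℝ, E) 𝓘(ℝ, F) ∞ q)
    (a : Jet E E Q Q × Jet F E X Q) (v : TangentSpace (actionModel E F) a) :
    (mfderiv (jetModel E E) 𝓘(ℝ, F) (q ∘ Jet.s) a.1 (prG a v) : F) =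
      (Jet.ofMap q a.1.s : Jet E F Q X).linear (sourceDeriv a v) := by
  rw [mfderiv_comp a.1 ((hq.contMDiff _).mdifferentiableAt (by simp)) (mdifferentiable_jet_s _)]
  rfl

theorem mfderiv_q_target (hq : IsSubmersion 𝓘(ℝ, E) 𝓘(ℝ, F) ∞ q)
    (a : Jet E E Q Q × Jet F E X Q) (v : TangentSpace (actionModel E F) a) :
    (mfderiv (jetModel E E) 𝓘(ℝ, F) (q ∘ Jet.t) a.1 (prG a v) : F) =
      (Jet.ofMap q a.1.t : Jet E F Q X).linear (targetDeriv a v) := by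
  rw [mfderiv_comp a.1 ((hq.contMDiff _).mdifferentiableAt (by simp)) (mdifferentiable_jet_t _)]
  rfl

/-- Needed because the differential of q̄ is meaningful only on vectors tangent to `pointJets`. -/
theorem prG_mem_subsetTangent {a : Jet E E Q Q × Jet F E X Q} (ha : a ∈ actionSpace E F q)
    {v : TangentSpace (actionModel E F) a} (hv : v ∈ actionTangent q a) :
    prG a v ∈ subsetTangent (jetModel E E) (pointJets E F q) a.1 := by
  have hF : IsSmoothExtensionAt (actionModel E F) (jetModel E E) Prod.fst (actionSpace E F q) a
      Prod.fst := .of_eventually (Eventually.of_forall fun _ => contMDiffAt_fst)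
        (Eventually.of_forall fun _ _ => rfl)
  have h := subsetDeriv_mem_subsetTangent ha ⟨_, hF⟩ (fun b hb => hb.1) hv (T := pointJets E F q)
  have e : subsetDeriv (actionModel E F) (jetModel E E) Prod.fst (actionSpace E F q) a v =
    prG a v := subsetDeriv_eq hF hv
  rwa [e] at h

/-- Differentiates the constraint p₁(h) = s(g) along the action space; `mfderiv_s_prP` does the same
for π(h) = q(s(g)). -/
theorem mfderiv_t_prP {a : Jet E E Q Q × Jet F E X Q}
    {v : TangentSpace (actionModel E F) a} (hv : v ∈ actionTangent q a) :
    (mfderiv (jetModel F E) 𝓘(ℝ, E) Jet.t a.2 (prP a v) : E) = sourceDeriv a v := by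
  rw [← mfderiv_source]
  have h := mfderiv_eq_of_mem_subsetTangent (I' := 𝓘(ℝ, E))
    (f₁ := (Jet.t : Jet F E X Q → Q) ∘ Prod.snd) (f₂ := (Jet.s : Jet E E Q Q → Q) ∘ Prod.fst)
    ((mdifferentiable_jet_t _).comp a mdifferentiableAt_snd)
    ((mdifferentiable_jet_s _).comp a mdifferentiableAt_fst)
    (eventually_mem_nhdsWithin.mono fun b hb => hb.2.2.symm) hv
  rw [mfderiv_comp a (mdifferentiable_jet_t _) mdifferentiableAt_snd] at h
  exact h

theorem mfderiv_s_prP (hq : IsSubmersion 𝓘(ℝ, E) 𝓘(ℝ, F) ∞ q) {a : Jet E E Q Q × Jet F E X Q}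
    {v : TangentSpace (actionModel E F) a} (hv : v ∈ actionTangent q a) :
    (mfderiv (jetModel F E) 𝓘(ℝ, F) Jet.s a.2 (prP a v) : F) =
      (Jet.ofMap q a.1.s : Jet E F Q X).linear (sourceDeriv a v) := by
  rw [← mfderiv_q_source hq]
  have h := mfderiv_eq_of_mem_subsetTangent (I' := 𝓘(ℝ, F))
    (f₁ := (Jet.s : Jet F E X Q → X) ∘ Prod.snd) (f₂ := (q ∘ Jet.s) ∘ Prod.fst)
    ((mdifferentiable_jet_s _).comp a mdifferentiableAt_snd)
    ((mdifferentiableAt_q_source hq _).comp a mdifferentiableAt_fst)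
    (eventually_mem_nhdsWithin.mono fun b hb => by
      change b.2.s = q b.1.s
      rw [(mem_sectionJets_iff.1 hb.2.1).1, hb.2.2]) hv
  rw [mfderiv_comp a (mdifferentiable_jet_s _) mdifferentiableAt_snd,
    mfderiv_comp a (mdifferentiableAt_q_source hq _) mdifferentiableAt_fst] at h
  exact h

theorem prOmega_apply (a : Jet E E Q Q × Jet F E X Q) (v : TangentSpace (actionModel E F) a) :
    prOmega a v = (targetDeriv a v - a.1.linear (sourceDeriv a v) : E) := rfl

theorem prTheta_apply (hq : IsSubmersion 𝓘(ℝ, E) 𝓘(ℝ, F) ∞ q) {a : Jet E E Q Q × Jet F E X Q}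
    {v : TangentSpace (actionModel E F) a} (hv : v ∈ actionTangent q a) :
    prTheta a v = (a.1.linear (sourceDeriv a v - a.2.linear
      ((Jet.ofMap q a.1.s : Jet E F Q X).linear (sourceDeriv a v))) : E) := by
  rw [← mfderiv_s_prP hq hv]
  nth_rewrite 1 [← mfderiv_t_prP hv]
  rfl

variable [CompleteSpace F]

/-- Here and in the next three lemmas a relation of base points is differentiated: s ∘ q̄ = q ∘ s, t
∘ q̄ = q ∘ t, p₁ ∘ m = t and π ∘ m = q ∘ t. -/
theorem mfderiv_s_baseJetDeriv (hq : IsSubmersion 𝓘(ℝ, E) 𝓘(ℝ, F) ∞ q)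
    {a : Jet E E Q Q × Jet F E X Q} (ha : a ∈ actionSpace E F q)
    {v : TangentSpace (actionModel E F) a} (hv : v ∈ actionTangent q a) :
    (mfderiv (jetModel F F) 𝓘(ℝ, F) Jet.s (baseJet E F q a.1) (baseJetDeriv q a.1 (prG a v)) : F) =
      (Jet.ofMap q a.1.s : Jet E F Q X).linear (sourceDeriv a v) := by
  rw [← mfderiv_q_source hq]
  exact mfderiv_subsetDeriv ha.1 (isSmoothOnSubset_baseJet hq _ ha.1) (mdifferentiable_jet_s _)
    (mdifferentiableAt_q_source hq _) (fun _ _ => baseJet_s) (prG_mem_subsetTangent ha hv)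

theorem mfderiv_t_baseJetDeriv (hq : IsSubmersion 𝓘(ℝ, E) 𝓘(ℝ, F) ∞ q)
    {a : Jet E E Q Q × Jet F E X Q} (ha : a ∈ actionSpace E F q)
    {v : TangentSpace (actionModel E F) a} (hv : v ∈ actionTangent q a) :
    (mfderiv (jetModel F F) 𝓘(ℝ, F) Jet.t (baseJet E F q a.1) (baseJetDeriv q a.1 (prG a v)) : F) =
      (Jet.ofMap q a.1.t : Jet E F Q X).linear (targetDeriv a v) := by
  rw [← mfderiv_q_target hq]
  exact mfderiv_subsetDeriv ha.1 (isSmoothOnSubset_baseJet hq _ ha.1) (mdifferentiable_jet_t _)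
    (mdifferentiableAt_q_target hq _) (fun _ hg => baseJet_t hq hg) (prG_mem_subsetTangent ha hv)

theorem mfderiv_t_actionDeriv (hq : IsSubmersion 𝓘(ℝ, E) 𝓘(ℝ, F) ∞ q)
    {a : Jet E E Q Q × Jet F E X Q} (ha : a ∈ actionSpace E F q)
    {v : TangentSpace (actionModel E F) a} (hv : v ∈ actionTangent q a) :
    (mfderiv (jetModel F E) 𝓘(ℝ, E) Jet.t (jetAction q a) (actionDeriv q (jetAction q) a v) : E) =
      targetDeriv a v := by
  rw [← mfderiv_target]
  exact mfderiv_subsetDeriv ha (isSmoothOnSubset_jetAction hq _ ha) (mdifferentiable_jet_t _)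
    ((mdifferentiable_jet_t _).comp a mdifferentiableAt_fst) (fun _ _ => rfl) hv

theorem mfderiv_s_actionDeriv (hq : IsSubmersion 𝓘(ℝ, E) 𝓘(ℝ, F) ∞ q)
    {a : Jet E E Q Q × Jet F E X Q} (ha : a ∈ actionSpace E F q)
    {v : TangentSpace (actionModel E F) a} (hv : v ∈ actionTangent q a) :
    (mfderiv (jetModel F E) 𝓘(ℝ, F) Jet.s (jetAction q a) (actionDeriv q (jetAction q) a v) : F) =
      (Jet.ofMap q a.1.t : Jet E F Q X).linear (targetDeriv a v) := by
  rw [← mfderiv_q_target hq]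
  have h := mfderiv_subsetDeriv ha (isSmoothOnSubset_jetAction hq _ ha) (mdifferentiable_jet_s _)
    ((mdifferentiableAt_q_target hq _).comp a mdifferentiableAt_fst)
    (fun b hb => baseJet_t hq hb.1) hv
  rw [mfderiv_comp a (mdifferentiableAt_q_target hq _) mdifferentiableAt_fst] at h
  exact h

theorem twistOmega_apply (hq : IsSubmersion 𝓘(ℝ, E) 𝓘(ℝ, F) ∞ q)
    {a : Jet E E Q Q × Jet F E X Q} (ha : a ∈ actionSpace E F q)
    {v : TangentSpace (actionModel E F) a} (hv : v ∈ actionTangent q a) :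
    twistOmega q a v = ((jetAction q a).linear
      ((Jet.ofMap q a.1.t : Jet E F Q X).linear (targetDeriv a v) - (baseJet E F q a.1).linear
        ((Jet.ofMap q a.1.s : Jet E F Q X).linear (sourceDeriv a v))) : E) := by
  rw [← mfderiv_s_baseJetDeriv hq ha hv, ← mfderiv_t_baseJetDeriv hq ha hv]
  rfl

theorem actionTheta_apply (hq : IsSubmersion 𝓘(ℝ, E) 𝓘(ℝ, F) ∞ q)
    {a : Jet E E Q Q × Jet F E X Q} (ha : a ∈ actionSpace E F q)
    {v : TangentSpace (actionModel E F) a} (hv : v ∈ actionTangent q a) :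
    actionTheta q (jetAction q) a v = (targetDeriv a v - (jetAction q a).linear
      ((Jet.ofMap q a.1.t : Jet E F Q X).linear (targetDeriv a v)) : E) := by
  rw [← mfderiv_s_actionDeriv hq ha hv]
  nth_rewrite 1 [← mfderiv_t_actionDeriv hq ha hv]
  rfl

/-- The relation between the Cartan forms of `J¹Diff_loc(q)`, `J¹Diff_loc(X)` and `J¹q`. -/
theorem prOmega_sub_twistOmega (hq : IsSubmersion 𝓘(ℝ, E) 𝓘(ℝ, F) ∞ q)
    {a : Jet E E Q Q × Jet F E X Q} (ha : a ∈ actionSpace E F q)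
    {v : TangentSpace (actionModel E F) a} (hv : v ∈ actionTangent q a) :
    prOmega a v - twistOmega q a v = actionTheta q (jetAction q) a v - prTheta a v := by
  rw [twistOmega_apply hq ha hv, actionTheta_apply hq ha hv, prTheta_apply hq hv, prOmega_apply]
  have h : ∀ w, (jetAction q a).linear ((baseJet E F q a.1).linear w) =
      a.1.linear (a.2.linear w) := fun w => DFunLike.congr_fun (jetAction_linear_comp hq ha) w
  -- With (g·h) ḡ = g h, both sides are T - gS - (g·h) Tq T + g h Tq S.
  rw [map_sub, map_sub, h]
  exact sub_sub_sub_comm _ _ _ _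

/-- Because ḡ ∘ Tq = Tq ∘ g, the form q̄^*ω_X is Tq ∘ ω_Q. Hence the term that spoils the Pfaffian
property vanishes on ker ω_Q. -/
theorem twistOmega_eq_comp_prOmega (hq : IsSubmersion 𝓘(ℝ, E) 𝓘(ℝ, F) ∞ q)
    {a : Jet E E Q Q × Jet F E X Q} (ha : a ∈ actionSpace E F q)
    {v : TangentSpace (actionModel E F) a} (hv : v ∈ actionTangent q a) :
    twistOmega q a v = ((jetAction q a).linear ((Jet.ofMap q a.1.t : Jet E F Q X).linear
      (prOmega a v)) : E) := by
  have h : ∀ w, (baseJet E F q a.1).linear ((Jet.ofMap q a.1.s : Jet E F Q X).linear w) =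
      (Jet.ofMap q a.1.t : Jet E F Q X).linear (a.1.linear w) :=
    fun w => DFunLike.congr_fun (congrArg Jet.linear (baseJet_comp hq ha.1)) w
  rw [twistOmega_apply hq ha hv, prOmega_apply, h, ← map_sub]

theorem isActionByPfaffianSymmetries_jetAction (hq : IsSubmersion 𝓘(ℝ, E) 𝓘(ℝ, F) ∞ q) :
    IsActionByPfaffianSymmetries q
      (jetAction q : Jet E E Q Q × Jet F E X Q → Jet F E X Q) := by
  have key : ∀ a ∈ actionSpace E F q, ∀ v ∈ actionTangent q a,
      prG a v ∈ groupoidDistribution (F := F) q a.1 → prP a v ∈ sectionDistribution q a.2 →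
      actionDeriv q (jetAction q) a v ∈ sectionDistribution q (jetAction q a) := by
    intro a ha v hv hG hP
    refine ⟨subsetDeriv_mem_subsetTangent ha (isSmoothOnSubset_jetAction hq _ ha)
      (fun b hb => jetAction_mem_sectionJets hq hb) hv, ?_⟩
    have h₁ : prOmega a v = (0 : E) := hG.2
    have h₂ : prTheta a v = (0 : E) :=
      (congrArg (fun w : E => a.1.linear w) hP.2).trans (map_zero a.1.linear)
    have h₃ : twistOmega q a v = (0 : E) := by
      rw [twistOmega_eq_comp_prOmega hq ha hv, h₁, map_zero, map_zero]
    -- Three of the four terms of the identity vanish, hence so does m^*θ_Q.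
    have h₄ : ∀ a b c d : E, a - b = c - d → a = 0 → d = 0 → b = 0 → c = 0 := by
      rintro _ _ c _ h rfl rfl rfl
      simpa using h.symm
    exact h₄ _ _ _ _ (prOmega_sub_twistOmega hq ha hv) h₁ h₂ h₃
  refine ⟨isSmoothGroupoidAction_jetAction hq, key,
    fun a ha v hv hG hP => ⟨key a ha v hv hG hP.1, ?_⟩⟩
  have h₁ : (targetDeriv a v - a.1.linear (sourceDeriv a v) : E) = 0 := hG.2
  -- For V in C with Tπ(V) = 0, the Cartan equation Tp₁(V) = h(Tπ(V)) forces Ts(W) = Tp₁(V) = 0.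
  -- Then W in ker ω_Q has Tt(W) = 0, so the image is π-vertical.
  have h₂ : sourceDeriv a v =
      a.2.linear (mfderiv (jetModel F E) 𝓘(ℝ, F) Jet.s a.2 (prP a v)) :=
    (mfderiv_t_prP hv).symm.trans (sub_eq_zero.1 hP.1.2)
  have h₃ : sourceDeriv a v = 0 :=
    h₂.trans ((congrArg (fun w : F => a.2.linear w) hP.2).trans (map_zero a.2.linear))
  rw [h₃, map_zero, sub_zero] at h₁
  refine (mfderiv_s_actionDeriv hq ha hv).trans ?_
  rw [h₁, map_zero]
  rfl

end CartanForms

/-! ### Translations in adapted charts; failure of the Pfaffian identity. -/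

section ChartTranslations

variable {E F Q X : Type*}
  [NormedAddCommGroup E] [NormedSpace ℝ E] [TopologicalSpace Q] [ChartedSpace E Q]
  [IsManifold 𝓘(ℝ, E) ∞ Q]
  [NormedAddCommGroup F] [NormedSpace ℝ F] [TopologicalSpace X] [ChartedSpace F X]
  [IsManifold 𝓘(ℝ, F) ∞ X]

/-- The translation by `u` in the chart `φ`. -/
def chartTranslation (φ : OpenPartialHomeomorph Q E) (u : E) : OpenPartialHomeomorph Q Q :=
  φ.trans ((Homeomorph.addRight u).toOpenPartialHomeomorph.trans φ.symm)

theorem chartTranslation_apply (φ : OpenPartialHomeomorph Q E) (u : E) (x : Q) :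
    chartTranslation φ u x = φ.symm (φ x + u) := rfl

theorem mem_chartTranslation_source {φ : OpenPartialHomeomorph Q E} {u : E} {x : Q} :
    x ∈ (chartTranslation φ u).source ↔ x ∈ φ.source ∧ φ x + u ∈ φ.target := by
  simp [chartTranslation]

theorem mem_chartTranslation_target {φ : OpenPartialHomeomorph Q E} {u : E} {x : Q} :
    x ∈ (chartTranslation φ u).target ↔ x ∈ φ.source ∧ φ x + -u ∈ φ.target := by
  simp only [chartTranslation, OpenPartialHomeomorph.trans_target]
  simp
  exact fun _ => Iff.rfl

/-- Joint smoothness in the translation vector and the point, so that the jets at a fixed point form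
a smooth curve as the vector varies. -/
theorem contMDiffAt_chartTranslation {φ : OpenPartialHomeomorph Q E}
    (hφ : φ ∈ IsManifold.maximalAtlas 𝓘(ℝ, E) ∞ Q) {u x} (hx : x ∈ φ.source)
    (hu : φ x + u ∈ φ.target) :
    ContMDiffAt (𝓘(ℝ, E).prod 𝓘(ℝ, E)) 𝓘(ℝ, E) ∞
      (fun p : E × Q => φ.symm (φ p.2 + p.1)) (u, x) := by
  refine ContMDiffAt.comp (g := φ.symm) (f := fun p : E × Q => φ p.2 + p.1) (u, x)
    (contMDiffAt_symm_of_mem_maximalAtlas hφ hu) ?_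
  exact (ContMDiffAt.comp (g := φ) (f := Prod.snd) (u, x) (contMDiffAt_of_mem_maximalAtlas hφ hx)
    contMDiffAt_snd).add contMDiffAt_fst

theorem isLocalDiffeo_chartTranslation {φ : OpenPartialHomeomorph Q E}
    (hφ : φ ∈ IsManifold.maximalAtlas 𝓘(ℝ, E) ∞ Q) (u : E) :
    IsLocalDiffeo E (chartTranslation φ u) := by
  have key : ∀ (u : E) (x : Q), x ∈ φ.source → φ x + u ∈ φ.target →
      ContMDiffAt 𝓘(ℝ, E) 𝓘(ℝ, E) ∞ (fun y => φ.symm (φ y + u)) x := fun u x hx hu =>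
    ContMDiffAt.comp (g := fun p : E × Q => φ.symm (φ p.2 + p.1)) (f := fun y => (u, y)) x
      (contMDiffAt_chartTranslation hφ hx hu) (contMDiffAt_const.prodMk contMDiffAt_id)
  refine ⟨fun x hx => ?_, fun x hx => ?_⟩
  · obtain ⟨h₁, h₂⟩ := mem_chartTranslation_source.1 hx
    exact (key u x h₁ h₂).contMDiffWithinAt
  · obtain ⟨h₁, h₂⟩ := mem_chartTranslation_target.1 hx
    exact (key (-u) x h₁ h₂).contMDiffWithinAt

/-- In the charts q is the linear map P, which intertwines translation by u with translation by P u.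
-/
theorem isLift_chartTranslation {q : Q → X} {φ : OpenPartialHomeomorph Q E}
    {ψ : OpenPartialHomeomorph X F} {P : E →L[ℝ] F}
    (hφ : φ ∈ IsManifold.maximalAtlas 𝓘(ℝ, E) ∞ Q) (hψ : ψ ∈ IsManifold.maximalAtlas 𝓘(ℝ, F) ∞ X)
    (hm : MapsTo q φ.source ψ.source) (h : ∀ y ∈ φ.source, ψ (q y) = P (φ y)) (u : E) :
    IsLift E F q (chartTranslation φ u) (chartTranslation ψ (P u)) := by
  have key : ∀ x ∈ (chartTranslation φ u).source,
      φ.symm (φ x + u) ∈ φ.source ∧ ψ (q (φ.symm (φ x + u))) = ψ (q x) + P u := by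
    intro x hx
    obtain ⟨h₁, h₂⟩ := mem_chartTranslation_source.1 hx
    have h₃ := φ.map_target h₂
    exact ⟨h₃, by rw [h _ h₃, φ.right_inv h₂, h x h₁, map_add]⟩
  refine ⟨isLocalDiffeo_chartTranslation hφ u, isLocalDiffeo_chartTranslation hψ (P u), ?_, ?_⟩
  · intro x hx
    refine mem_chartTranslation_source.2 ⟨hm (mem_chartTranslation_source.1 hx).1, ?_⟩
    rw [← (key x hx).2]
    exact ψ.map_source (hm (key x hx).1)
  · intro x hx
    rw [chartTranslation_apply, chartTranslation_apply, ← (key x hx).2,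
      ψ.left_inv (hm (key x hx).1)]

variable {q : Q → X}

/-- Given (1), the Pfaffian identity would force the twist to vanish. It is tested on the velocity
of a curve with h and s(g) fixed and t(g) moving across the fibres of q. -/
theorem not_isPfaffianAction_jetAction [CompleteSpace F] [Nonempty Q] [Nontrivial F]
    (hq : IsSubmersion 𝓘(ℝ, E) 𝓘(ℝ, F) ∞ q) :
    ¬ IsPfaffianAction q (jetAction q : Jet E E Q Q × Jet F E X Q → Jet F E X Q) := by
  intro hPf
  obtain ⟨x⟩ := ‹Nonempty Q›
  obtain ⟨w, hw⟩ := exists_ne (0 : F)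
  obtain ⟨φ, ψ, P, R, hx, hm, hφ, hψ, hPR, h⟩ := IsSubmersion.exists_charts hq x
  obtain ⟨L, hL⟩ := IsSubmersion.exists_rightInverse hq x
  set h₀ : Jet F E X Q := Jet.ofLinear (q x) x L
  have hh₀ : h₀ ∈ sectionJets E F q := mem_sectionJets_iff.2 ⟨rfl, hL⟩
  -- Since P (R w) = w, the translated point projects to a curve in X with chart velocity w ≠ 0.
  set u : ℝ → E := fun τ => τ • R w with hu
  have hud : ContMDiff 𝓘(ℝ, ℝ) 𝓘(ℝ, E) ∞ u := ContDiff.contMDiff (by fun_prop)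
  set c : ℝ → Jet E E Q Q × Jet F E X Q := fun τ => (Jet.ofMap (chartTranslation φ (u τ)) x, h₀)
    with hc
  have htgt : ∀ᶠ τ in 𝓝 (0 : ℝ), φ x + u τ ∈ φ.target := by
    have : ContinuousAt (fun τ => φ x + u τ) 0 := continuousAt_const.add hud.continuous.continuousAt
    refine this.eventually (φ.open_target.mem_nhds ?_)
    simpa [hu] using φ.map_source hx
  have hcd : ∀ᶠ τ in 𝓝 (0 : ℝ), ContMDiffAt 𝓘(ℝ, ℝ) (actionModel E F) ∞ c τ ∧
      c τ ∈ actionSpace E F q := by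
    filter_upwards [htgt] with τ hτ
    refine ⟨ContMDiffAt.prodMk ?_ contMDiffAt_const, ?_⟩
    · refine Jet.contMDiffAt_ofMap (f := fun τ => chartTranslation φ (u τ)) (g := fun _ => x) ?_
        contMDiffAt_const
      exact ContMDiffAt.comp (g := fun p : E × Q => φ.symm (φ p.2 + p.1))
        (f := fun p : ℝ × Q => (u p.1, p.2)) (τ, x) (contMDiffAt_chartTranslation hφ hx hτ)
        ((ContMDiffAt.comp (g := u) (f := Prod.fst) (τ, x) (hud τ) contMDiffAt_fst).prodMk
          contMDiffAt_snd)
    · exact ⟨⟨_, _, x, isLift_chartTranslation hφ hψ hm h _,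
        mem_chartTranslation_source.2 ⟨hx, hτ⟩, rfl⟩, hh₀, rfl⟩
  have ha := hcd.self_of_nhds.2
  have hc₀ : MDifferentiableAt 𝓘(ℝ, ℝ) (actionModel E F) c 0 :=
    hcd.self_of_nhds.1.mdifferentiableAt (by simp)
  set v : TangentSpace (actionModel E F) (c 0) :=
    mfderiv 𝓘(ℝ, ℝ) (actionModel E F) c 0 (1 : ℝ) with hvdef
  have hv : v ∈ actionTangent q (c 0) := ⟨c, hcd, rfl⟩
  have hs : sourceDeriv (c 0) v = 0 := by
    rw [← mfderiv_source]
    have e := mfderiv_comp (0 : ℝ) (I := 𝓘(ℝ, ℝ)) (I'' := 𝓘(ℝ, E)) (f := c)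
      (g := (Jet.s : Jet E E Q Q → Q) ∘ Prod.fst)
      ((mdifferentiable_jet_s _).comp (c 0) mdifferentiableAt_fst) hc₀
    -- Every jet on the curve is taken at x, so the S-part of the twist drops out.
    have e' : ((Jet.s : Jet E E Q Q → Q) ∘ Prod.fst) ∘ c = fun _ => x := rfl
    rw [e', mfderiv_const] at e
    exact (DFunLike.congr_fun (F := ℝ →L[ℝ] E) e 1).symm
  -- What is left of the twist is (g·h)(Tq T) = 0, and applying Tq, of which g·h is a right inverse,
  -- gives Tq T = 0.
  have hz : (Jet.ofMap q (c 0).1.t : Jet E F Q X).linear (targetDeriv (c 0) v) = 0 := by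
    have h₁ : ∀ a b c : E, a = c → a - b = c → b = 0 := by
      rintro a b _ rfl h
      exact sub_eq_self.1 h
    have h₂ := h₁ _ _ _ (hPf _ ha v hv) (prOmega_sub_twistOmega hq ha hv)
    rw [twistOmega_apply hq ha hv, hs, map_zero, map_zero, sub_zero] at h₂
    have h₃ := DFunLike.congr_fun (mem_sectionJets_iff.1 (jetAction_mem_sectionJets hq ha)).2
      ((Jet.ofMap q (c 0).1.t : Jet E F Q X).linear (targetDeriv (c 0) v))
    rw [ContinuousLinearMap.comp_apply, h₂, map_zero] at h₃
    exact h₃.symm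
  have hψd : MDifferentiableAt 𝓘(ℝ, F) 𝓘(ℝ, F) ψ (q (c 0).1.t) := by
    refine (contMDiffAt_of_mem_maximalAtlas hψ (hm ?_)).mdifferentiableAt (by simp)
    exact φ.map_target htgt.self_of_nhds
  have hqt : MDifferentiableAt (actionModel E F) 𝓘(ℝ, F) ((q ∘ Jet.t) ∘ Prod.fst) (c 0) :=
    (mdifferentiableAt_q_target hq _).comp (c 0) mdifferentiableAt_fst
  -- The projected target curve is a straight line in the chart ψ. Its velocity w is Tψ(Tq T), which
  -- contradicts Tq T = 0.
  have hcurve : ψ ∘ (((q ∘ Jet.t) ∘ Prod.fst) ∘ c) =ᶠ[𝓝 0] fun τ : ℝ => P (φ x) + τ • w := by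
    filter_upwards [htgt] with τ hτ
    change ψ (q (φ.symm (φ x + u τ))) = _
    rw [h _ (φ.map_target hτ), φ.right_inv hτ, map_add, hu, map_smul, hPR]
  have hder : HasDerivAt (fun τ : ℝ => P (φ x) + τ • w) w 0 := by
    simpa using ((hasDerivAt_id (0 : ℝ)).smul_const w).const_add (P (φ x))
  have e₁ := hcurve.mfderiv_eq (I := 𝓘(ℝ, ℝ)) (I' := 𝓘(ℝ, F))
  rw [mfderiv_comp (0 : ℝ) hψd (hqt.comp _ hc₀), mfderiv_comp (0 : ℝ) hqt hc₀,
    mfderiv_comp (c 0) (mdifferentiableAt_q_target hq _) mdifferentiableAt_fst,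
    mfderiv_eq_fderiv] at e₁
  have e₂ := DFunLike.congr_fun (F := ℝ →L[ℝ] F) e₁ 1
  have e₃ : (mfderiv (jetModel E E) 𝓘(ℝ, F) (q ∘ Jet.t) (c 0).1 (prG (c 0) v) : F) = 0 :=
    (mfderiv_q_target hq _ _).trans hz
  have e₄ : fderiv ℝ (fun τ : ℝ => P (φ x) + τ • w) 0 1 = w := by
    rw [fderiv_apply_one_eq_deriv, hder.deriv]
  refine hw (e₄.symm.trans (e₂.symm.trans ?_))
  exact (congrArg (mfderiv 𝓘(ℝ, F) 𝓘(ℝ, F) ψ (q (c 0).1.t) : F →L[ℝ] F) e₃).trans (map_zero _)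

end ChartTranslations

end

theorem mainTheorem11 {E F Q X : Type*}
    [NormedAddCommGroup E] [NormedSpace ℝ E] [FiniteDimensional ℝ E]
    [NormedAddCommGroup F] [NormedSpace ℝ F] [FiniteDimensional ℝ F]
    [TopologicalSpace Q] [ChartedSpace E Q] [IsManifold 𝓘(ℝ, E) ∞ Q]
    [TopologicalSpace X] [ChartedSpace F X] [IsManifold 𝓘(ℝ, F) ∞ X]
    (q : Q → X) (hq : IsSubmersion 𝓘(ℝ, E) 𝓘(ℝ, F) ∞ q) :
    IsSmoothOnSubset (jetModel E E) (jetModel F F) (baseJet E F q) (pointJets E F q) ∧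
    (∀ a ∈ actionSpace E F q, ∀ v ∈ actionTangent q a,
      prOmega a v - twistOmega q a v = actionTheta q (jetAction q) a v - prTheta a v) ∧
    (Nonempty Q → Nontrivial F →
      ¬ IsPfaffianAction q (jetAction q : Jet E E Q Q × Jet F E X Q → Jet F E X Q)) ∧
    IsActionByPfaffianSymmetries q (jetAction q : Jet E E Q Q × Jet F E X Q → Jet F E X Q) := by
  -- Completeness of F makes inversion of linear maps of F smooth, as the splitting of Tq and the
  -- factor ḡ⁻¹ in the action require.
  have := FiniteDimensional.complete ℝ F
  exact ⟨isSmoothOnSubset_baseJet hq, fun _ ha _ hv => prOmega_sub_twistOmega hq ha hv,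
    fun _ _ => not_isPfaffianAction_jetAction hq, isActionByPfaffianSymmetries_jetAction hq⟩
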